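/- Let $n\ge 0$, $k\ge 0$, let $1\le i_1<i_2<\dots<i_k<n$ be integers, and let $m=i_1+\dots+i_k$. **Definitions.** $\mathcal I_n(321)$ is the set of permutations $\pi$ of $\{1,\dots,n\}$ with $\pi=\pi^{-1}$ for which there are no $a<b<c$ with $\pi(a)>\pi(b)>\pi(c)$, and $\mathrm{Des}(\pi)=\{i: 1\le i<n,\ \pi(i)>\pi(i+1)\}$. Lattice paths start at the origin and have steps $N=(0,1)$ and $E=(1,0)$. $\mathcal P_n$ is the set of Dyck path prefixes, i.e. of paths with $n$ steps that do not go below the line $y=x$; $\mathcal G_n$ is the set of Grand Dyck paths, i.e. of paths with $n$ steps from $(0,0)$ to $(\lceil n/2\rceil,\lfloor n/2\rfloor)$. A peak of a path is a vertex in the middle of two consecutive steps $NE$. $B_n$ is the box with $\lfloor n/2\rfloor$ rows and $\lceil n/2\rceil$ columns, with lower-left corner at the origin, and $\lambda\subseteq B_n$ means that the Young diagram of the partition $\lambda$ fits inside $B_n$. The hook decomposition $\mathrm{hd}(\lambda)$ is the set of the sizes of the hooks obtained by successively peeling off the largest hook (first row together with first column) of the Young diagram, $d$ times, where $d$ is the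 side of the Durfee square of $\lambda$, that is, the largest $d$ with $\lambda_d\ge d$ (and $d=0$ if $\lambda$ is empty). The map $\rho$ on $\mathcal I_n(321)$: apply the Robinson–Schensted algorithm to $\pi$; the $t$-th step of $\rho(\pi)$ is $N$ if $t$ is in the first row of the recording tableau (which for an involution equals the insertion tableau), and $E$ otherwise. The map $\xi$ on $\mathcal P_n$: match an $N$ step with a later $E$ step if the part of the path strictly between them is a (translated, possibly empty) Dyck path. If $j$ steps remain unmatched (all of them are $N$ steps), $\xi$ changes the first $\lceil j/2\rceil$ unmatched steps into $E$ steps. The map $\psi$ on $\{\lambda\subseteq B_n\}$: split the lower-right boundary of $\lambda$ in $B_n$, read as a path from $(0,0)$ to $(\lceil n/2\rceil,\lfloor n/2\rfloor)$, as $AB$ where $A$ has $\lfloor n/2\rfloor$ steps. Counting from the splitting point, starting with position $1$, let $a_1<\dots<a_d$ be the positions of the $E$ steps of $A$ and $b_1<\dots<b_d$ the positions of the $N$ steps of $B$. Then $\psi(\lambda)$ is the path in $\mathcal G_n$ whose peaks are exactly the points $(b_j-1,a_j)$, $1\le j\le d$. **Theorem.** The map $\rho$ is a bijection $\mathcal I_n(321)\to\mathcal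 P_n$; the map $\xi$ is a bijection $\mathcal P_n\to\mathcal G_n$; for every $\lambda\subseteq B_n$ there is exactly one path in $\mathcal G_n$ with the peaks required of $\psi(\lambda)$, and $\psi$ is a bijection $\{\lambda\subseteq B_n\}\to\mathcal G_n$. The composite $\psi^{-1}\circ\xi\circ\rho$ restricts to a bijection $$\{\pi\in\mathcal I_n(321):\mathrm{Des}(\pi)=\{i_1,\dots,i_k\}\}\longrightarrow\{\lambda\vdash m:\ \mathrm{hd}(\lambda)=\{i_1,\dots,i_k\},\ \lambda\subseteq B_n\}.$$ -/

import Mathlib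

namespace HookDescent

/-! ### Lattice paths -/

/-- The steps of a lattice path: `N = (0,1)` and `E = (1,0)`. -/
inductive Step : Type
  | N : Step
  | E : Step
  deriving DecidableEq

/-- A lattice path starting at the origin is the list of its steps. It does not go below the line
`y = x` if every initial segment has at least as many `N` steps as `E` steps. -/
def StaysAbove (w : List Step) : Prop :=
  ∀ i ≤ w.length, (w.take i).count Step.E ≤ (w.take i).count Step.N

instance (w : List Step) : Decidable (StaysAbove w) := by
  unfold StaysAbove; infer_instance

/-- Dyck path prefixes of length `n`. -/
def dyckPrefixes (n : ℕ) : Set (List Step) :=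
  {w | w.length = n ∧ StaysAbove w}

/-- Grand Dyck paths of length `n`: paths with `n` steps from the origin to `(⌈n/2⌉, ⌊n/2⌋)`. -/
def grandDyckPaths (n : ℕ) : Set (List Step) :=
  {w | w.length = n ∧ w.count Step.E = (n + 1) / 2 ∧ w.count Step.N = n / 2}

/-- The coordinates of the vertices of the path `w` that are peaks, that is, that lie in the
middle of an occurrence of `NE`. The vertex with label `p + 1` lies between the steps with
(zero-based) indices `p` and `p + 1`. -/
def peakCoords (w : List Step) : Finset (ℕ × ℕ) :=
  ((Finset.range w.length).filter
      fun p => w[p]? = some Step.N ∧ w[p + 1]? = some Step.E).image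
    fun p => ((w.take (p + 1)).count Step.E, (w.take (p + 1)).count Step.N)

/-! ### Permutations -/

/-- `π` avoids the pattern `321`. -/
def Avoids321 {n : ℕ} (π : Equiv.Perm (Fin n)) : Prop :=
  ∀ i j k : Fin n, i < j → j < k → ¬ (π j < π i ∧ π k < π j)

/-- The `321`-avoiding involutions of `[n]` (the identity is an involution). -/
def involutions321 (n : ℕ) : Set (Equiv.Perm (Fin n)) :=
  {π | π⁻¹ = π ∧ Avoids321 π}

/-- The descent set of `π`, with positions numbered from `1`. -/
def descentSet {n : ℕ} (π : Equiv.Perm (Fin n)) : Finset ℕ :=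
  (Finset.univ.filter fun i : Fin n =>
      ∃ h : (i : ℕ) + 1 < n, π ⟨(i : ℕ) + 1, h⟩ < π i).image
    fun i : Fin n => (i : ℕ) + 1

/-! ### The Robinson-Schensted algorithm

A tableau is the list of its rows, from top to bottom. -/

/-- Insert `x` into a row: `x` replaces the leftmost entry greater than `x`, which is bumped, or
is put at the end of the row if there is no such entry. -/
def insertInRow (x : ℕ) : List ℕ → List ℕ × Option ℕ
  | [] => ([x], none)
  | y :: r => if x < y then (x :: r, some y)
      else (y :: (insertInRow x r).1, (insertInRow x r).2)

/-- Insert `x` into a tableau: the entry bumped from a row is inserted into the next row. Returns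
the resulting tableau and the (zero-based) index of the row in which the new box appears. -/
def insertInTableau : ℕ → List (List ℕ) → List (List ℕ) × ℕ
  | x, [] => ([[x]], 0)
  | x, r :: T =>
    match insertInRow x r with
    | (r', none) => (r' :: T, 0)
    | (r', some y) => (r' :: (insertInTableau y T).1, (insertInTableau y T).2 + 1)

/-- Add a box with entry `t` at the end of row `i`. -/
def addBox (t : ℕ) : ℕ → List (List ℕ) → List (List ℕ)
  | _, [] => [[t]]
  | 0, r :: T => (r ++ [t]) :: T
  | i + 1, r :: T => r :: addBox t i T

/-- Insert the letters of a word one after the other, starting from the pair `PQ` of an insertion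
and a recording tableau, the first letter being inserted at time `t`. -/
def rsFrom : ℕ → List (List ℕ) × List (List ℕ) → List ℕ → List (List ℕ) × List (List ℕ)
  | _, PQ, [] => PQ
  | t, PQ, x :: w =>
    rsFrom (t + 1)
      ((insertInTableau x PQ.1).1, addBox t (insertInTableau x PQ.1).2 PQ.2) w

/-- The Robinson-Schensted pair (insertion tableau, recording tableau) of `π`, obtained from the
word `π(1) ⋯ π(n)` with letters in `{1, …, n}`. -/
def robinsonSchensted {n : ℕ} (π : Equiv.Perm (Fin n)) :
    List (List ℕ) × List (List ℕ) :=
  rsFrom 1 ([], []) (List.ofFn fun i => (π i : ℕ) + 1)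

/-- The map `ρ`: the `t`-th step is `N` if `t` is in the first row of the recording tableau and
`E` otherwise. For a `321`-avoiding involution the two tableaux agree and have at most two rows,
so that `E` means that `t` is in the second row. -/
def rho {n : ℕ} (π : Equiv.Perm (Fin n)) : List Step :=
  (List.range n).map fun t =>
    if t + 1 ∈ (robinsonSchensted π).2.getD 0 [] then Step.N else Step.E

/-! ### The map `ξ` -/

/-- The `N` step with index `p` and the `E` step with index `q > p` face each other: the segment
between their midpoints has slope `1` and stays below the path, that is, the part of the path
strictly between the two steps is a Dyck path. -/
def Faces (w : List Step) (p q : ℕ) : Prop :=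
  p < q ∧ w[p]? = some Step.N ∧ w[q]? = some Step.E ∧
    StaysAbove ((w.drop (p + 1)).take (q - p - 1)) ∧
    ((w.drop (p + 1)).take (q - p - 1)).count Step.E =
      ((w.drop (p + 1)).take (q - p - 1)).count Step.N

instance (w : List Step) (p q : ℕ) : Decidable (Faces w p q) := by
  unfold Faces; infer_instance

/-- The indices of the unmatched steps of `w`, in increasing order. -/
def unmatched (w : List Step) : List ℕ :=
  (List.range w.length).filter fun p =>
    decide (∀ q < w.length, ¬ Faces w p q ∧ ¬ Faces w q p)

/-- The map `ξ`: if there are `j` unmatched steps, the first `⌈j/2⌉` of them (in a Dyck path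
prefix all of them are `N` steps) are changed into `E` steps. -/
def xi (w : List Step) : List Step :=
  w.mapIdx fun p s =>
    if p ∈ (unmatched w).take (((unmatched w).length + 1) / 2) then Step.E else s

/-! ### Partitions, identified with their Young diagrams -/

/-- `lam` fits inside the box with `⌊n/2⌋` rows and `⌈n/2⌉` columns. -/
def partitionsInBox (n : ℕ) : Set YoungDiagram :=
  {lam | ∀ c ∈ lam, c.1 < n / 2 ∧ c.2 < (n + 1) / 2}

/-- The largest hook of `lam`: its first column together with its first row. -/
def largestHook (lam : YoungDiagram) : Finset (ℕ × ℕ) :=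
  lam.cells.filter fun c => c.1 = 0 ∨ c.2 = 0

/-- The diagram that remains when the largest hook of `lam` is removed, moved back to the
corner. -/
def peel (lam : YoungDiagram) : YoungDiagram where
  cells := lam.cells.filter fun c => (c.1 + 1, c.2 + 1) ∈ lam
  isLowerSet := by
    intro a b hba ha
    simp only [Finset.coe_filter, Set.mem_ofPred_eq, YoungDiagram.mem_cells] at ha ⊢
    exact ⟨lam.up_left_mem hba.1 hba.2 ha.1,
      lam.up_left_mem (Nat.succ_le_succ hba.1) (Nat.succ_le_succ hba.2) ha.2⟩

/-- The side of the Durfee square: the largest `k` such that the `k`-th part of `lam` is at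
least `k` (and `0` if `lam` is empty). -/
def durfee (lam : YoungDiagram) : ℕ :=
  Nat.findGreatest (fun k => k ≤ lam.rowLen (k - 1)) lam.card

/-- The hook decomposition of `lam`: the sizes of the successive largest hooks. -/
def hookDecomposition (lam : YoungDiagram) : Finset ℕ :=
  (Finset.range (durfee lam)).image fun j => (largestHook (peel^[j] lam)).card

/-! ### The map `ψ` -/

/-- The lower-right boundary of `lam` inside the box with `⌊n/2⌋` rows and `⌈n/2⌉` columns, as a
path from the lower-left to the upper-right corner of the box: the rows of the box are traversed
from the bottom to the top. -/
def boundary (n : ℕ) (lam : YoungDiagram) : List Step :=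
  ((List.range (n / 2)).reverse.flatMap fun r =>
      List.replicate (lam.rowLen r - lam.rowLen (r + 1)) Step.E ++ [Step.N]) ++
    List.replicate ((n + 1) / 2 - lam.rowLen 0) Step.E

/-- The positions, numbered from `1`, of the steps equal to `s` in `w`, in increasing order. -/
def positions (s : Step) (w : List Step) : List ℕ :=
  ((List.range w.length).filter fun p => decide (w[p]? = some s)).map fun p => p + 1

/-- The boundary is split as `A ++ B`, where `A` has `⌊n/2⌋` steps. If `a₁ < ⋯ < a_k` are the
positions of the `E` steps of `A` and `b₁ < ⋯ < b_k` the positions of the `N` steps of `B`, both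
counted starting at the splitting point, these are the points `(b_j - 1, a_j)`. -/
def hookPoints (n : ℕ) (lam : YoungDiagram) : Finset (ℕ × ℕ) :=
  ((List.zip (positions Step.E ((boundary n lam).take (n / 2)).reverse)
      (positions Step.N ((boundary n lam).drop (n / 2)))).map
    fun ab => (ab.2 - 1, ab.1)).toFinset

/-- `G` is a Grand Dyck path of length `n` whose peaks are exactly the points `(b_j - 1, a_j)`
of `lam`. -/
def IsHookToPeak (n : ℕ) (lam : YoungDiagram) (G : List Step) : Prop :=
  G ∈ grandDyckPaths n ∧ peakCoords G = hookPoints n lam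

/-- The hook-to-peak map `ψ`: the Grand Dyck path that has its peaks at the points
`(b_j - 1, a_j)` of `lam`. -/
noncomputable def psi (n : ℕ) (lam : YoungDiagram) : List Step :=
  Classical.epsilon (IsHookToPeak n lam)

/-- The composite `ψ⁻¹ ∘ ξ ∘ ρ`, where `ψ⁻¹` is the inverse of `ψ` on the partitions that fit in
the box. -/
noncomputable def mainMap (n : ℕ) (π : Equiv.Perm (Fin n)) : YoungDiagram :=
  Function.invFunOn (psi n) (partitionsInBox n) (xi (rho π))

end HookDescent

/-! Each of the three maps is a bijection, and the descent set is carried along them until it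
becomes the set of hook sizes.

For a 321-avoiding involution the `N` steps of `rho` are the weak excedances `t ≤ π t`
(`mem_first_row_iff`). Such a `π` is increasing on the weak excedances and increasing on the
deficiencies, so it descends exactly where a weak excedance is followed by a deficiency, that is, at
a peak (`descentSet_eq_peakPositions`). Injectivity reconstructs `π` from the largest index
downwards. For surjectivity, the matched `N` and `E` steps are paired in increasing order and the
unmatched steps are fixed (`exists_involution_of_staysAbove`).

The map `xi` touches unmatched steps only, and these still read `E ⋯ E N ⋯ N`, so the matching
survives (`unmatched_eq_of_agree`). The inverse turns every unmatched step back into `N`; the end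
point of a Grand Dyck path dictates how many of them are `E` (`two_mul_count_E`). A peak is a facing
pair of adjacent steps, so peak positions do not change (`peakPositions_xi`).

The points defining `psi` are `(rowLen r - r - 1, colLen r - r)` for the diagonal cells `(r, r)`.
They form a chain, hence are the peaks of exactly one Grand Dyck path (`exists_path_with_peaks`,
`eq_of_peakCoords_eq`), and they determine the boundary of the partition. So `psi` is injective;
since `boundary` is a bijection between the same finite sets, `psi` is surjective too. The
coordinate sum of such a point is both the position of the peak and the size of the hook at `(r, r)`
(`hookDecomposition_eq_image`). Finally, the hooks partition the diagram, so its size is the sum of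
its hook sizes. -/

namespace HookDescent

/-! ### Heights and counts along a word -/

/-- The height `#N - #E` of the path `w` after `i` steps. -/
def height (w : List Step) (i : ℕ) : ℤ :=
  ((w.take i).count Step.N : ℤ) - (w.take i).count Step.E

lemma count_take_succ {w : List Step} {p : ℕ} {s : Step} (h : w[p]? = some s) (t : Step) :
    (w.take (p + 1)).count t = (w.take p).count t + if s = t then 1 else 0 := by
  rw [List.take_add_one, h, List.count_append]
  simp [List.count_singleton]

lemma count_take_succ_of_length_le {w : List Step} {p : ℕ} (h : w.length ≤ p) (t : Step) :
    (w.take (p + 1)).count t = (w.take p).count t := by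
  rw [List.take_of_length_le h, List.take_of_length_le (by omega)]

lemma height_succ_N {w : List Step} {p : ℕ} (h : w[p]? = some Step.N) :
    height w (p + 1) = height w p + 1 := by
  simp [height, count_take_succ h]; ring

lemma height_succ_E {w : List Step} {p : ℕ} (h : w[p]? = some Step.E) :
    height w (p + 1) = height w p - 1 := by
  simp [height, count_take_succ h]; ring

lemma height_zero (w : List Step) : height w 0 = 0 := by simp [height]

lemma lt_length_of_getElem? {w : List Step} {p : ℕ} {s : Step} (h : w[p]? = some s) :
    p < w.length := by
  by_contra hc
  rw [List.getElem?_eq_none (by omega)] at h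
  cases h

lemma step_cases {w : List Step} {p : ℕ} (h : p < w.length) :
    w[p]? = some Step.N ∨ w[p]? = some Step.E := by
  rw [List.getElem?_eq_getElem h]
  cases w[p] <;> simp

lemma count_take_eq_card (w : List Step) (s : Step) (i : ℕ) :
    (w.take i).count s = ((Finset.range i).filter fun p => w[p]? = some s).card := by
  induction i with
  | zero => simp
  | succ i ih =>
    rw [Finset.range_add_one, Finset.filter_insert]
    by_cases h : i < w.length
    · have h' := List.getElem?_eq_getElem h
      rw [count_take_succ h', ih]
      by_cases hs : w[i] = s
      · rw [if_pos hs, if_pos (by rw [h', hs]), Finset.card_insert_of_notMem (by simp)]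
      · rw [if_neg hs, if_neg (by rw [h']; simpa using hs), add_zero]
    · rw [count_take_succ_of_length_le (by omega), ih, if_neg]
      rw [List.getElem?_eq_none (by omega)]; simp

lemma count_eq_card (w : List Step) (s : Step) :
    w.count s = ((Finset.range w.length).filter fun p => w[p]? = some s).card := by
  rw [← count_take_eq_card, List.take_length]

lemma count_N_add_count_E (w : List Step) :
    w.count Step.N + w.count Step.E = w.length := by
  induction w with
  | nil => rfl
  | cons s w ih => cases s <;> simp <;> omega

lemma staysAbove_iff (w : List Step) :
    StaysAbove w ↔ ∀ i ≤ w.length, 0 ≤ height w i := by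
  simp [StaysAbove, height]

lemma ext_steps {u v : List Step} (h : u.length = v.length)
    (hE : ∀ p : ℕ, u[p]? = some Step.E ↔ v[p]? = some Step.E) : u = v := by
  refine List.ext_getElem? fun p => ?_
  by_cases hp : p < u.length
  · have := hE p
    rcases step_cases hp with h1 | h1 <;> rcases step_cases (h ▸ hp) with h2 | h2 <;>
      simp_all
  · rw [List.getElem?_eq_none (by omega), List.getElem?_eq_none (by omega)]

/-! ### Facing steps -/

lemma count_take_add (w : List Step) (a k : ℕ) (s : Step) :
    (w.take (a + k)).count s = (w.take a).count s + ((w.drop a).take k).count s := by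
  rw [List.take_add, List.count_append]

lemma height_drop_take (w : List Step) (a k i : ℕ) (hi : i ≤ k) :
    height ((w.drop a).take k) i = height w (a + i) - height w a := by
  simp only [height, List.take_take, min_eq_left hi, count_take_add]
  push_cast; ring

/-- Heights turn the search for partners into first-return and last-passage arguments. -/
lemma faces_iff (w : List Step) (p q : ℕ) :
    Faces w p q ↔ p < q ∧ w[p]? = some Step.N ∧ w[q]? = some Step.E ∧
      height w q = height w (p + 1) ∧ ∀ i, p < i → i ≤ q → height w (p + 1) ≤ height w i := by
  unfold Faces
  refine and_congr_right fun hpq => and_congr_right fun hN => and_congr_right fun hE => ?_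
  have hq := lt_length_of_getElem? hE
  have hlen : ((w.drop (p + 1)).take (q - p - 1)).length = q - p - 1 := by
    simp; omega
  rw [staysAbove_iff, hlen, and_comm]
  refine and_congr ?_ ?_
  · have h := height_drop_take w (p + 1) (q - p - 1) (q - p - 1) le_rfl
    rw [show p + 1 + (q - p - 1) = q by omega] at h
    have h2 : height ((w.drop (p + 1)).take (q - p - 1)) (q - p - 1) =
        ((w.drop (p + 1)).take (q - p - 1)).count Step.N -
        ((w.drop (p + 1)).take (q - p - 1)).count Step.E := by
      simp [height, List.take_take]
    omega
  · constructor
    · intro h i h1 h2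
      have := h (i - (p + 1)) (by omega)
      rw [height_drop_take _ _ _ _ (by omega), show p + 1 + (i - (p + 1)) = i by omega] at this
      omega
    · intro h i h1
      rw [height_drop_take _ _ _ _ h1]
      have := h (p + 1 + i) (by omega) (by omega)
      omega

lemma Faces.lt_length {w : List Step} {p q : ℕ} (h : Faces w p q) : q < w.length :=
  lt_length_of_getElem? h.2.2.1

lemma Faces.right_unique {w : List Step} {p q q' : ℕ} (h : Faces w p q) (h' : Faces w p q') :
    q = q' := by
  wlog hlt : q < q' generalizing q q'
  · rcases lt_trichotomy q q' with h1 | h1 | h1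
    · exact this h h' h1
    · exact h1
    · exact (this h' h h1).symm
  rw [faces_iff] at h h'
  have h1 := h'.2.2.2.2 (q + 1) (by omega) hlt
  have h2 := height_succ_E h.2.2.1
  omega

lemma Faces.left_unique {w : List Step} {p p' q : ℕ} (h : Faces w p q) (h' : Faces w p' q) :
    p = p' := by
  wlog hlt : p < p' generalizing p p'
  · rcases lt_trichotomy p p' with h1 | h1 | h1
    · exact this h h' h1
    · exact h1
    · exact (this h' h h1).symm
  rw [faces_iff] at h h'
  have h1 := h.2.2.2.2 p' (by omega) (by omega)
  have h2 := height_succ_N h'.2.1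
  omega

/-- The first return after `p` to the level before `p` is made by an `E` step, and this step is the
partner. -/
lemma exists_faces_right {w : List Step} {p i : ℕ} (hN : w[p]? = some Step.N) (hpi : p < i)
    (hi : i ≤ w.length) (h : height w i ≤ height w p) : ∃ q, Faces w p q := by
  classical
  have hex : ∃ i, p < i ∧ i ≤ w.length ∧ height w i ≤ height w p := ⟨i, hpi, hi, h⟩
  obtain ⟨h1, h2, h3⟩ := Nat.find_spec hex
  have hmin := fun j => @Nat.find_min _ _ hex j
  generalize Nat.find hex = k at h1 h2 h3 hmin
  obtain ⟨q, rfl⟩ : ∃ q, k = q + 1 := ⟨k - 1, by omega⟩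
  have hs := height_succ_N hN
  have hmin' : ∀ j, p < j → j ≤ q → height w p < height w j := fun j hj hj' => by
    have := hmin j (by omega)
    simp only [not_and, not_le] at this
    exact this hj (by omega)
  have hpq : p < q := by
    rcases Nat.lt_or_ge p q with h | h
    · exact h
    · obtain rfl : p = q := by omega
      omega
  have hq := hmin' q hpq le_rfl
  refine ⟨q, (faces_iff _ _ _).2 ⟨hpq, hN, ?_⟩⟩
  rcases step_cases (w := w) (p := q) (by omega) with hs' | hs'
  · have := height_succ_N hs'; omega
  · have := height_succ_E hs'
    exact ⟨hs', by omega, fun j hj hj' => by have := hmin' j hj hj'; omega⟩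

/-- Time-reversed first return: the partner starts at the last vertex up to `q` that is no higher
than the end of the step `q`. -/
lemma exists_faces_left {w : List Step} {q i : ℕ} (hE : w[q]? = some Step.E) (hi : i ≤ q)
    (h : height w i ≤ height w (q + 1)) : ∃ p, Faces w p q := by
  classical
  have hspec := Nat.findGreatest_spec (P := fun i => height w i ≤ height w (q + 1)) hi h
  have hmax := fun j => @Nat.findGreatest_is_greatest j
    (fun i => height w i ≤ height w (q + 1)) _ q
  have hle := Nat.findGreatest_le (P := fun i => height w i ≤ height w (q + 1)) q
  set p := Nat.findGreatest (fun i => height w i ≤ height w (q + 1)) q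
  have hs := height_succ_E hE
  have hpq : p < q := by
    rcases hle.lt_or_eq with h | h
    · exact h
    · rw [h] at hspec; omega
  have hmax' : ∀ j, p < j → j ≤ q → height w (q + 1) < height w j := fun j hj hj' => by
    simpa using hmax j hj hj'
  have hq := lt_length_of_getElem? hE
  have h1 := hmax' (p + 1) (by omega) (by omega)
  refine ⟨p, (faces_iff _ _ _).2 ⟨hpq, ?_⟩⟩
  rcases step_cases (w := w) (p := p) (by omega) with hs' | hs'
  · have := height_succ_N hs'
    exact ⟨hs', hE, by omega, fun j hj hj' => by have := hmax' j hj hj'; omega⟩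
  · have := height_succ_E hs'; omega

lemma mem_unmatched {w : List Step} {p : ℕ} :
    p ∈ unmatched w ↔ p < w.length ∧ ∀ q, ¬ Faces w p q ∧ ¬ Faces w q p := by
  simp only [unmatched, List.mem_filter, List.mem_range, decide_eq_true_eq]
  refine and_congr_right fun hp => ⟨fun h q => ?_, fun h q _ => h q⟩
  exact ⟨fun hf => (h q hf.lt_length).1 hf, fun hf => (h q (hf.1.trans hp)).2 hf⟩

lemma Faces.left_notMem {w : List Step} {p q : ℕ} (h : Faces w p q) : p ∉ unmatched w :=
  fun hp => ((mem_unmatched.1 hp).2 q).1 h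

lemma Faces.right_notMem {w : List Step} {p q : ℕ} (h : Faces w p q) : q ∉ unmatched w :=
  fun hp => ((mem_unmatched.1 hp).2 p).2 h

lemma exists_faces_of_N {w : List Step} {p : ℕ} (hN : w[p]? = some Step.N)
    (hp : p ∉ unmatched w) : ∃ q, Faces w p q := by
  rw [mem_unmatched] at hp
  push Not at hp
  obtain ⟨q, hq⟩ := hp (lt_length_of_getElem? hN)
  by_cases h : Faces w p q
  · exact ⟨q, h⟩
  · have := (hq h).2.2.1
    rw [hN] at this; cases this

lemma exists_faces_of_E {w : List Step} {q : ℕ} (hE : w[q]? = some Step.E)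
    (hq : q ∉ unmatched w) : ∃ p, Faces w p q := by
  rw [mem_unmatched] at hq
  push Not at hq
  obtain ⟨p, hp⟩ := hq (lt_length_of_getElem? hE)
  by_cases h : Faces w q p
  · have := h.2.1
    rw [hE] at this; cases this
  · exact ⟨p, hp h⟩

/-- Between `p` and `q` the path stays above its level before `p` and after `q`, so an `N` step in
between must be undone by time `q + 1`, and an `E` step undoes a rise made since `p`. -/
lemma Faces.between_notMem {w : List Step} {p q r : ℕ} (h : Faces w p q) (h1 : p ≤ r)
    (h2 : r ≤ q) : r ∉ unmatched w := by
  rcases h1.eq_or_lt with rfl | h1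
  · exact h.left_notMem
  rcases h2.eq_or_lt with rfl | h2
  · exact h.right_notMem
  have hq := h.lt_length
  rw [faces_iff] at h
  have hN := height_succ_N h.2.1
  have hE := height_succ_E h.2.2.1
  rcases step_cases (w := w) (p := r) (by omega) with hs | hs
  · have := h.2.2.2.2 r h1 h2.le
    obtain ⟨q', hq'⟩ := exists_faces_right (i := q + 1) hs (by omega) (by omega) (by omega)
    exact hq'.left_notMem
  · have := h.2.2.2.2 (r + 1) (by omega) (by omega)
    obtain ⟨p', hp'⟩ := exists_faces_left (i := p) hs (by omega) (by omega)
    exact hp'.right_notMem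

/-- Compare the heights before `p` and after `q`: if the latter is not higher, the `N` step finds a
partner; otherwise the `E` step does. -/
lemma not_N_E_of_unmatched {w : List Step} {p q : ℕ} (hp : p ∈ unmatched w)
    (hq : q ∈ unmatched w) (hpq : p < q) :
    ¬ (w[p]? = some Step.N ∧ w[q]? = some Step.E) := by
  rintro ⟨hN, hE⟩
  rcases le_total (height w (q + 1)) (height w p) with h | h
  · obtain ⟨q', h'⟩ := exists_faces_right hN (by omega : p < q + 1) (lt_length_of_getElem? hE) h
    exact h'.left_notMem hp
  · obtain ⟨p', h'⟩ := exists_faces_left hE hpq.le h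
    exact h'.right_notMem hq

lemma Faces.congr {w w' : List Step} {p q : ℕ} (h : Faces w p q)
    (hw : ∀ r, p ≤ r → r ≤ q → w'[r]? = w[r]?) : Faces w' p q := by
  have hl : (w'.drop (p + 1)).take (q - p - 1) = (w.drop (p + 1)).take (q - p - 1) := by
    refine List.ext_getElem? fun r => ?_
    simp only [List.getElem?_take, List.getElem?_drop]
    split_ifs with hr
    · exact hw _ (by omega) (by omega)
    · rfl
  unfold Faces at h ⊢
  rw [hl, hw p le_rfl h.1.le, hw q h.1.le le_rfl]
  exact h

/-- Changing unmatched steps so that they still read `E ⋯ E N ⋯ N` does not affect which steps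
are unmatched. -/
lemma unmatched_eq_of_agree {w w' : List Step} (hlen : w'.length = w.length)
    (hag : ∀ p, p ∉ unmatched w → w'[p]? = w[p]?)
    (hU : ∀ p ∈ unmatched w, ∀ q ∈ unmatched w, p < q →
      ¬ (w'[p]? = some Step.N ∧ w'[q]? = some Step.E)) :
    unmatched w' = unmatched w := by
  -- Old facing pairs survive because no unmatched step lies inside one.
  have hF : ∀ p q, Faces w p q → Faces w' p q := fun p q h =>
    h.congr fun r h1 h2 => hag r (h.between_notMem h1 h2)
  unfold unmatched
  rw [hlen]
  refine List.filter_congr fun p hp => ?_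
  rw [List.mem_range] at hp
  have key : p ∈ unmatched w' ↔ p ∈ unmatched w := by
    constructor
    · intro h
      by_contra hn
      rcases step_cases hp with hs | hs
      · obtain ⟨q, hq⟩ := exists_faces_of_N hs hn
        exact (hF _ _ hq).left_notMem h
      · obtain ⟨q, hq⟩ := exists_faces_of_E hs hn
        exact (hF _ _ hq).right_notMem h
    · intro h
      rw [mem_unmatched, hlen]
      refine ⟨hp, fun q => ⟨fun hf => ?_, fun hf => ?_⟩⟩
      -- A new partner of an unmatched step would be either unmatched, which `hU` forbids, or
      -- already matched in `w'`, against uniqueness.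
      · by_cases hq : q ∈ unmatched w
        · exact hU p h q hq hf.1 ⟨hf.2.1, hf.2.2.1⟩
        · obtain ⟨p', hp'⟩ := exists_faces_of_E ((hag q hq).symm.trans hf.2.2.1) hq
          have := (hF _ _ hp').left_unique hf
          exact hp'.left_notMem (this ▸ h)
      · by_cases hq : q ∈ unmatched w
        · exact hU q hq p h hf.1 ⟨hf.2.1, hf.2.2.1⟩
        · obtain ⟨p', hp'⟩ := exists_faces_of_N ((hag q hq).symm.trans hf.2.1) hq
          have := (hF _ _ hp').right_unique hf
          exact hp'.right_notMem (this ▸ h)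
  simp only [unmatched, List.mem_filter, List.mem_range, hlen, hp, true_and] at key
  exact Bool.eq_iff_iff.2 key

/-! ### Counting matched steps -/

/-- Send each matched `E` step to its partner. The partner comes strictly earlier, whence the bound
`i - 1`, which `exists_involution_of_staysAbove` needs. -/
lemma card_E_le_card_N (w : List Step) (i : ℕ) :
    ((Finset.range i).filter fun q => w[q]? = some Step.E ∧ q ∉ unmatched w).card ≤
    ((Finset.range (i - 1)).filter fun p => w[p]? = some Step.N ∧ p ∉ unmatched w).card := by
  classical
  have hex : ∀ q : ℕ, ∃ p, w[q]? = some Step.E ∧ q ∉ unmatched w → Faces w p q := fun q => by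
    by_cases h : w[q]? = some Step.E ∧ q ∉ unmatched w
    · obtain ⟨p, hp⟩ := exists_faces_of_E h.1 h.2
      exact ⟨p, fun _ => hp⟩
    · exact ⟨0, fun h' => absurd h' h⟩
  choose f hf using hex
  refine Finset.card_le_card_of_injOn f ?_ ?_
  · intro q hq
    simp only [Finset.coe_filter, Finset.mem_range, Set.mem_ofPred_eq] at hq ⊢
    have h := hf q hq.2
    exact ⟨by have := h.1; omega, h.2.1, h.left_notMem⟩
  · intro q hq q' hq' h
    simp only [Finset.coe_filter, Finset.mem_range, Set.mem_ofPred_eq] at hq hq'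
    have h1 := hf q hq.2
    rw [h] at h1
    exact h1.right_unique (hf q' hq'.2)

lemma card_N_le_card_E {w : List Step} {i : ℕ} (hi : ∀ p q, Faces w p q → p < i → q < i) :
    ((Finset.range i).filter fun p => w[p]? = some Step.N ∧ p ∉ unmatched w).card ≤
    ((Finset.range i).filter fun q => w[q]? = some Step.E ∧ q ∉ unmatched w).card := by
  classical
  have hex : ∀ p : ℕ, ∃ q, w[p]? = some Step.N ∧ p ∉ unmatched w → Faces w p q := fun q => by
    by_cases h : w[q]? = some Step.N ∧ q ∉ unmatched w
    · obtain ⟨p, hp⟩ := exists_faces_of_N h.1 h.2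
      exact ⟨p, fun _ => hp⟩
    · exact ⟨0, fun h' => absurd h' h⟩
  choose f hf using hex
  refine Finset.card_le_card_of_injOn f ?_ ?_
  · intro q hq
    simp only [Finset.coe_filter, Finset.mem_range, Set.mem_ofPred_eq] at hq ⊢
    have h := hf q hq.2
    exact ⟨hi _ _ h hq.1, h.2.2.1, h.right_notMem⟩
  · intro q hq q' hq' h
    simp only [Finset.coe_filter, Finset.mem_range, Set.mem_ofPred_eq] at hq hq'
    have h1 := hf q hq.2
    rw [h] at h1
    exact h1.left_unique (hf q' hq'.2)

/-- Before a cut that separates no two facing steps, there are as many matched `N` steps as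
matched `E` steps. -/
lemma card_matched_N_eq_card_matched_E {w : List Step} {i : ℕ}
    (hi : ∀ p q, Faces w p q → p < i → q < i) :
    ((Finset.range i).filter fun p => w[p]? = some Step.N ∧ p ∉ unmatched w).card =
    ((Finset.range i).filter fun q => w[q]? = some Step.E ∧ q ∉ unmatched w).card := by
  refine (card_N_le_card_E hi).antisymm ((card_E_le_card_N w i).trans (Finset.card_le_card ?_))
  exact Finset.filter_subset_filter _ (Finset.range_mono (by omega))

/-- If the path stays above, an `E` step ends at height at least that of the origin, so it has a
partner. Conversely, if every `E` step is matched, each is preceded by its own `N` step. -/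
lemma staysAbove_iff_unmatched (w : List Step) :
    StaysAbove w ↔ ∀ q ∈ unmatched w, w[q]? = some Step.N := by
  constructor
  · intro h q hq
    rw [staysAbove_iff] at h
    have hql := (mem_unmatched.1 hq).1
    rcases step_cases hql with hs | hs
    · exact hs
    · obtain ⟨p, hp⟩ := exists_faces_left (i := 0) hs (by omega)
        (by rw [height_zero]; exact h _ hql)
      exact absurd hq hp.right_notMem
  · intro h i _
    rw [count_take_eq_card, count_take_eq_card]
    calc _ ≤ ((Finset.range i).filter fun q => w[q]? = some Step.E ∧ q ∉ unmatched w).card := by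
          refine Finset.card_le_card fun q hq => ?_
          rw [Finset.mem_filter] at hq ⊢
          refine ⟨hq.1, hq.2, fun hu => ?_⟩
          have := h q hu
          rw [hq.2] at this; cases this
      _ ≤ _ := card_E_le_card_N w i
      _ ≤ _ := by
          refine Finset.card_le_card fun q hq => ?_
          simp only [Finset.mem_filter, Finset.mem_range] at hq ⊢
          exact ⟨by omega, hq.2.1⟩

lemma unmatched_pairwise (w : List Step) : (unmatched w).Pairwise (· < ·) :=
  List.Pairwise.filter _ List.pairwise_lt_range

lemma unmatched_nodup (w : List Step) : (unmatched w).Nodup :=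
  (unmatched_pairwise w).imp fun h => h.ne

lemma count_eq_card_matched_add (w : List Step) (s : Step) :
    w.count s =
      ((Finset.range w.length).filter fun p => w[p]? = some s ∧ p ∉ unmatched w).card +
      ((unmatched w).toFinset.filter fun p => w[p]? = some s).card := by
  rw [count_eq_card, ← Finset.card_filter_add_card_filter_not (fun p : ℕ => p ∉ unmatched w),
    Finset.filter_filter]
  congr 2
  ext p
  simp only [Finset.mem_filter, Finset.mem_range, List.mem_toFinset, not_not]
  exact ⟨fun h => ⟨h.2, h.1.2⟩, fun h => ⟨⟨(mem_unmatched.1 h.1).1, h.2⟩, h.1⟩⟩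

/-- In a word with `j` unmatched steps, `e` of which are `E`, there are `(length - j) / 2 + e`
steps `E`. -/
lemma two_mul_count_E (w : List Step) :
    2 * w.count Step.E + (unmatched w).length = w.length +
      2 * ((unmatched w).toFinset.filter fun p => w[p]? = some Step.E).card := by
  have h1 := count_eq_card_matched_add w Step.E
  have h2 := count_eq_card_matched_add w Step.N
  have h3 := count_N_add_count_E w
  have h4 := card_matched_N_eq_card_matched_E (w := w) (i := w.length)
    fun p q h _ => h.lt_length
  have h5 : ((unmatched w).toFinset.filter fun p => w[p]? = some Step.N) =
      (unmatched w).toFinset.filter fun p => ¬ w[p]? = some Step.E := by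
    refine Finset.filter_congr fun p hp => ?_
    rw [List.mem_toFinset] at hp
    rcases step_cases (mem_unmatched.1 hp).1 with h | h <;> simp [h]
  have h6 := Finset.card_filter_add_card_filter_not (s := (unmatched w).toFinset)
    (fun p : ℕ => w[p]? = some Step.E)
  rw [List.toFinset_card_of_nodup (unmatched_nodup w), ← h5] at h6
  omega

/-! ### The map `ξ` -/

/-- Initial segments of a chain are nested. This identifies the unmatched `E` steps of a Grand Dyck
path with the steps that `xi` changes in its preimage. -/
lemma eq_of_initial_segments {U D D' : Finset ℕ} (hD : D ⊆ U) (hD' : D' ⊆ U)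
    (hi : ∀ p ∈ U, ∀ q ∈ D, p < q → p ∈ D) (hi' : ∀ p ∈ U, ∀ q ∈ D', p < q → p ∈ D')
    (hc : D.card = D'.card) : D = D' := by
  refine Finset.eq_of_subset_of_card_le (fun x hx => ?_) hc.ge
  by_contra hx'
  have hsub : D' ⊂ D := by
    refine Finset.ssubset_iff_subset_ne.2 ⟨fun y hy => ?_, fun h => hx' (h ▸ hx)⟩
    rcases lt_trichotomy x y with h | h | h
    · exact absurd (hi' x (hD hx) y hy h) hx'
    · exact h ▸ hx
    · exact hi y (hD' hy) x hx h
  have := Finset.card_lt_card hsub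
  omega

/-- The indices of the steps that `ξ` changes. -/
def flipped (w : List Step) : List ℕ :=
  (unmatched w).take (((unmatched w).length + 1) / 2)

lemma flipped_subset {w : List Step} {p : ℕ} (h : p ∈ flipped w) : p ∈ unmatched w :=
  List.mem_of_mem_take h

lemma mem_flipped_of_lt {w : List Step} {p q : ℕ} (hp : p ∈ unmatched w) (hq : q ∈ flipped w)
    (hpq : p < q) : p ∈ flipped w := by
  have h := unmatched_pairwise w
  rw [← List.take_append_drop (((unmatched w).length + 1) / 2) (unmatched w)] at h hp
  rcases List.mem_append.1 hp with h1 | h1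
  · exact h1
  · have := (List.pairwise_append.1 h).2.2 q hq p h1
    omega

lemma card_flipped (w : List Step) :
    (flipped w).toFinset.card = ((unmatched w).length + 1) / 2 := by
  rw [flipped, List.toFinset_card_of_nodup ((unmatched_nodup w).sublist (List.take_sublist _ _)),
    List.length_take]
  omega

lemma length_xi (w : List Step) : (xi w).length = w.length := by simp [xi]

lemma xi_getElem? (w : List Step) (p : ℕ) :
    (xi w)[p]? = if p ∈ flipped w then some Step.E else w[p]? := by
  unfold xi
  rw [List.getElem?_mapIdx]
  change Option.map (fun s => if p ∈ flipped w then Step.E else s) w[p]? = _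
  split_ifs with h
  · rw [List.getElem?_eq_getElem (mem_unmatched.1 (flipped_subset h)).1]; rfl
  · simp

lemma xi_getElem?_of_notMem {w : List Step} {p : ℕ} (h : p ∉ unmatched w) :
    (xi w)[p]? = w[p]? := by
  rw [xi_getElem?, if_neg fun h' => h (flipped_subset h')]

section
variable {n : ℕ} {w : List Step}

lemma unmatched_xi (hw : StaysAbove w) : unmatched (xi w) = unmatched w := by
  refine unmatched_eq_of_agree (length_xi w) (fun p hp => xi_getElem?_of_notMem hp) ?_
  rintro p hp q hq hpq ⟨h1, h2⟩
  rw [staysAbove_iff_unmatched] at hw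
  rw [xi_getElem?] at h1 h2
  have hq' : q ∈ flipped w := by
    by_contra h
    rw [if_neg h, hw q hq] at h2; cases h2
  rw [if_pos (mem_flipped_of_lt hp hq' hpq)] at h1
  cases h1

lemma filter_E_unmatched_xi (hw : StaysAbove w) :
    ((unmatched w).toFinset.filter fun p => (xi w)[p]? = some Step.E) = (flipped w).toFinset := by
  rw [staysAbove_iff_unmatched] at hw
  ext p
  simp only [Finset.mem_filter, List.mem_toFinset, xi_getElem?]
  constructor
  · rintro ⟨h1, h2⟩
    by_contra h
    rw [if_neg h, hw p h1] at h2; cases h2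
  · intro h
    exact ⟨flipped_subset h, by rw [if_pos h]⟩

lemma xi_mapsTo (n : ℕ) : Set.MapsTo xi (dyckPrefixes n) (grandDyckPaths n) := by
  rintro w ⟨hl, hw⟩
  have h1 := two_mul_count_E (xi w)
  rw [unmatched_xi hw, filter_E_unmatched_xi hw, card_flipped, length_xi] at h1
  have h2 := count_N_add_count_E (xi w)
  have h3 := two_mul_count_E w
  rw [length_xi] at h2
  refine ⟨by rw [length_xi, hl], ?_, ?_⟩ <;> omega

lemma xi_injOn (n : ℕ) : Set.InjOn xi (dyckPrefixes n) := by
  rintro w ⟨hl, hw⟩ v ⟨hl', hv⟩ h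
  have hu : unmatched w = unmatched v := by rw [← unmatched_xi hw, ← unmatched_xi hv, h]
  rw [staysAbove_iff_unmatched] at hw hv
  refine List.ext_getElem? fun p => ?_
  by_cases hp : p ∈ unmatched w
  · rw [hw p hp, hv p (hu ▸ hp)]
  · rw [← xi_getElem?_of_notMem hp, h, xi_getElem?_of_notMem (hu ▸ hp)]

/-- The preimage has all unmatched steps of `g` set to `N`. In `g` the unmatched `E` steps come
first, and the end point forces their number to be half of the unmatched steps, rounded up, so `xi`
restores exactly them. -/
lemma xi_surjOn (n : ℕ) : Set.SurjOn xi (dyckPrefixes n) (grandDyckPaths n) := by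
  rintro g ⟨hl, hE, hN⟩
  set w := g.mapIdx fun p s => if p ∈ unmatched g then Step.N else s with hw
  have hlw : w.length = g.length := by simp [hw]
  have hget : ∀ p, w[p]? = if p ∈ unmatched g then some Step.N else g[p]? := fun p => by
    rw [hw, List.getElem?_mapIdx]
    split_ifs with h
    · rw [List.getElem?_eq_getElem (mem_unmatched.1 h).1]; rfl
    · simp
  have hu : unmatched w = unmatched g := by
    refine unmatched_eq_of_agree hlw (fun p hp => by rw [hget, if_neg hp]) ?_
    rintro p hp q hq - ⟨-, h2⟩
    rw [hget, if_pos hq] at h2; cases h2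
  have hsa : StaysAbove w := by
    rw [staysAbove_iff_unmatched, hu]
    intro q hq
    rw [hget, if_pos hq]
  have hD : ((unmatched g).toFinset.filter fun p => g[p]? = some Step.E) =
      (flipped w).toFinset := by
    refine eq_of_initial_segments (U := (unmatched g).toFinset) (Finset.filter_subset _ _)
      (fun p hp => ?_) ?_ ?_ ?_
    · rw [List.mem_toFinset] at hp ⊢
      rw [← hu]; exact flipped_subset hp
    · intro p hp q hq hpq
      simp only [Finset.mem_filter, List.mem_toFinset] at hp hq ⊢
      refine ⟨hp, (step_cases (mem_unmatched.1 hp).1).resolve_left fun h => ?_⟩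
      exact not_N_E_of_unmatched hp hq.1 hpq ⟨h, hq.2⟩
    · intro p hp q hq hpq
      rw [List.mem_toFinset] at hp hq ⊢
      exact mem_flipped_of_lt (hu ▸ hp) hq hpq
    · rw [card_flipped, hu]
      have := two_mul_count_E g
      omega
  refine ⟨w, ⟨hlw.trans hl, hsa⟩, List.ext_getElem? fun p => ?_⟩
  have hDp := Finset.ext_iff.1 hD p
  rw [Finset.mem_filter, List.mem_toFinset, List.mem_toFinset] at hDp
  rw [xi_getElem?, hget]
  split_ifs with h1 h2
  · exact (hDp.2 h1).2.symm
  · rcases step_cases (mem_unmatched.1 h2).1 with h | h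
    · exact h.symm
    · exact absurd (hDp.1 ⟨h2, h⟩) h1
  · rfl

lemma xi_bijOn (n : ℕ) : Set.BijOn xi (dyckPrefixes n) (grandDyckPaths n) :=
  ⟨xi_mapsTo n, xi_injOn n, xi_surjOn n⟩

/-! ### Peaks -/

/-- The positions of the peaks of a word: the numbers of steps before them. -/
def peakPositions (w : List Step) : Finset ℕ :=
  ((Finset.range w.length).filter
      fun p => w[p]? = some Step.N ∧ w[p + 1]? = some Step.E).image fun p => p + 1

lemma faces_of_peak {p : ℕ} (h : w[p]? = some Step.N) (h' : w[p + 1]? = some Step.E) :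
    Faces w p (p + 1) := by
  rw [faces_iff]
  refine ⟨by omega, h, h', rfl, fun i h1 h2 => ?_⟩
  rw [show i = p + 1 by omega]

lemma peakPositions_xi (hw : StaysAbove w) : peakPositions (xi w) = peakPositions w := by
  unfold peakPositions
  rw [length_xi]
  congr 1
  refine Finset.filter_congr fun p _ => ⟨fun ⟨h, h'⟩ => ?_, fun ⟨h, h'⟩ => ?_⟩
  · have hf := faces_of_peak h h'
    have h1 := hf.left_notMem
    have h2 := hf.right_notMem
    rw [unmatched_xi hw] at h1 h2
    rw [xi_getElem?_of_notMem h1] at h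
    rw [xi_getElem?_of_notMem h2] at h'
    exact ⟨h, h'⟩
  · have hf := faces_of_peak h h'
    rw [xi_getElem?_of_notMem hf.left_notMem, xi_getElem?_of_notMem hf.right_notMem]
    exact ⟨h, h'⟩

lemma image_add_peakCoords (w : List Step) :
    (peakCoords w).image (fun c => c.1 + c.2) = peakPositions w := by
  unfold peakCoords peakPositions
  rw [Finset.image_image]
  refine Finset.image_congr fun p hp => ?_
  simp only [Finset.coe_filter, Finset.mem_range, Set.mem_ofPred_eq] at hp
  have := count_N_add_count_E (w.take (p + 1))
  rw [List.length_take] at this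
  simp only [Function.comp]
  omega

end

/-! ### Robinson-Schensted insertion -/

lemma insertInRow_of_forall_le {x : ℕ} {r : List ℕ} (h : ∀ y ∈ r, y ≤ x) :
    insertInRow x r = (r ++ [x], none) := by
  induction r with
  | nil => rfl
  | cons y r ih =>
    have hy := h y (by simp)
    rw [insertInRow, if_neg (by omega), ih fun z hz => h z (by simp [hz])]
    rfl

lemma insertInRow_append_cons {x y : ℕ} {a b : List ℕ} (h : ∀ z ∈ a, z ≤ x) (hxy : x < y) :
    insertInRow x (a ++ y :: b) = (a ++ x :: b, some y) := by
  induction a with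
  | nil => simp [insertInRow, hxy]
  | cons z a ih =>
    have hz := h z (by simp)
    rw [List.cons_append, insertInRow, if_neg (by omega), ih fun z hz => h z (by simp [hz])]
    rfl

lemma rsFrom_append (u v : List ℕ) (t : ℕ) (PQ : List (List ℕ) × List (List ℕ)) :
    rsFrom t PQ (u ++ v) = rsFrom (t + u.length) (rsFrom t PQ u) v := by
  induction u generalizing t PQ with
  | nil => rfl
  | cons x u ih =>
    rw [List.cons_append, rsFrom, ih, rsFrom, List.length_cons]
    congr 1
    omega

/-- The rows of a tableau with at most one row, whose row is `r`. -/
def singleRow (r : List ℕ) : List (List ℕ) :=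
  if r = [] then [] else [r]

lemma insertInTableau_singleRow {x : ℕ} {r : List ℕ} (h : ∀ y ∈ r, y ≤ x) :
    insertInTableau x (singleRow r) = (singleRow (r ++ [x]), 0) := by
  unfold singleRow
  by_cases hr : r = []
  · simp [hr, insertInTableau]
  · simp [hr, insertInTableau, insertInRow_of_forall_le h]

lemma addBox_zero_singleRow (t : ℕ) (r : List ℕ) :
    addBox t 0 (singleRow r) = singleRow (r ++ [t]) := by
  unfold singleRow
  by_cases hr : r = []
  · simp [hr, addBox]
  · simp [hr, addBox]

section
variable {p : ℕ → ℕ}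

/-- The pair of tableaux obtained from the first `t` letters of a `321`-avoiding involution `p`
(on `ℕ`, positions numbered from `0`). -/
def IsPartialPair (p : ℕ → ℕ) (t : ℕ) (PQ : List (List ℕ) × List (List ℕ)) : Prop :=
  ∃ r₁ r₂ q₁ q₂ : List ℕ, PQ = (r₁ :: singleRow r₂, q₁ :: singleRow q₂) ∧
    r₁.Pairwise (· < ·) ∧ (∀ x, x ∈ r₁ ↔ ∃ s < t, x = p s + 1 ∧ (t ≤ p s ∨ p s ≤ s)) ∧
    (∀ x ∈ r₂, x ≤ t) ∧ (∀ x, x ∈ q₁ ↔ ∃ s < t, s ≤ p s ∧ x = s + 1)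

/-- A weak excedance exceeds all earlier values: if `p s > p t ≥ t` with `s < t`, then the positions
`s < t < p s` carry a 321. So the new letter is appended to the first row. -/
lemma IsPartialPair.step_of_le (hinv : ∀ s, p (p s) = s)
    (hav : ∀ a b c, a < b → b < c → ¬ (p b < p a ∧ p c < p b)) {t : ℕ}
    {PQ : List (List ℕ) × List (List ℕ)} (h : IsPartialPair p t PQ) (ht : t ≤ p t) :
    IsPartialPair p (t + 1) ((insertInTableau (p t + 1) PQ.1).1,
      addBox (t + 1) (insertInTableau (p t + 1) PQ.1).2 PQ.2) := by
  obtain ⟨r₁, r₂, q₁, q₂, rfl, hs, hr₁, hr₂, hq₁⟩ := h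
  have hlt : ∀ s < t, p s < p t := fun s hst => by
    by_contra hc
    rcases (not_lt.1 hc).eq_or_lt with h | h
    · have := congrArg p h
      rw [hinv, hinv] at this; omega
    · exact hav s t (p s) hst (by omega) ⟨h, by rw [hinv]; omega⟩
  have hr : ∀ y ∈ r₁, y < p t + 1 := fun y hy => by
    obtain ⟨s, hst, rfl, -⟩ := (hr₁ y).1 hy
    have := hlt s hst
    omega
  have hI : insertInTableau (p t + 1) (r₁ :: singleRow r₂) =
      ((r₁ ++ [p t + 1]) :: singleRow r₂, 0) := by
    simp [insertInTableau, insertInRow_of_forall_le fun y hy => (hr y hy).le]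
  refine ⟨r₁ ++ [p t + 1], r₂, q₁ ++ [t + 1], q₂, by rw [hI]; simp [addBox], ?_, ?_, ?_, ?_⟩
  · rw [List.pairwise_append]
    exact ⟨hs, by simp, by simpa using hr⟩
  · intro x
    rw [List.mem_append, hr₁, List.mem_singleton]
    constructor
    · rintro (⟨s, hst, rfl, h⟩ | rfl)
      · refine ⟨s, by omega, rfl, ?_⟩
        rcases h with h | h
        -- The borderline `p s = t` would give `p t = s < t`, so replacing `t` by `t + 1` in the
        -- description of the row loses nothing.
        · have h1 := hlt s hst
          rcases h.eq_or_lt with h2 | h2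
          · have := hinv s
            rw [← h2] at this; omega
          · omega
        · exact Or.inr h
      · exact ⟨t, by omega, rfl, by omega⟩
    · rintro ⟨s, hst, rfl, h⟩
      rcases (Nat.lt_succ_iff.1 hst).eq_or_lt with rfl | h1
      · exact Or.inr rfl
      · exact Or.inl ⟨s, h1, rfl, by omega⟩
  · intro x hx
    have := hr₂ x hx
    omega
  · intro x
    rw [List.mem_append, hq₁, List.mem_singleton]
    constructor
    · rintro (⟨s, hst, h, rfl⟩ | rfl)
      · exact ⟨s, by omega, h, rfl⟩
      · exact ⟨t, by omega, ht, rfl⟩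
    · rintro ⟨s, hst, h, rfl⟩
      rcases (Nat.lt_succ_iff.1 hst).eq_or_lt with rfl | h1
      · exact Or.inr rfl
      · exact Or.inl ⟨s, h1, h, rfl⟩

/-- The value `t` was inserted at time `p t` and still is in the first row. By 321-avoidance the
smaller entries of the row are below `p t`, so exactly `t` is bumped, and it is larger than
everything in the second row. -/
lemma IsPartialPair.step_of_lt (hinv : ∀ s, p (p s) = s)
    (hav : ∀ a b c, a < b → b < c → ¬ (p b < p a ∧ p c < p b)) {t : ℕ}
    {PQ : List (List ℕ) × List (List ℕ)} (h : IsPartialPair p t PQ) (ht : p t < t) :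
    IsPartialPair p (t + 1) ((insertInTableau (p t + 1) PQ.1).1,
      addBox (t + 1) (insertInTableau (p t + 1) PQ.1).2 PQ.2) := by
  obtain ⟨r₁, r₂, q₁, q₂, rfl, hs, hr₁, hr₂, hq₁⟩ := h
  have hmem : t + 1 ∈ r₁ := (hr₁ _).2 ⟨p t, ht, by rw [hinv], by rw [hinv]; omega⟩
  obtain ⟨a, b, rfl⟩ := List.append_of_mem hmem
  have hs' := List.pairwise_append.1 hs
  have hb : ∀ z ∈ b, t + 1 < z := (List.pairwise_cons.1 hs'.2.1).1
  have ha : ∀ z ∈ a, z < t + 1 := fun z hz => hs'.2.2 z hz (t + 1) (by simp)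
  have ha' : ∀ z ∈ a, z < p t + 1 := fun z hz => by
    have h1 := ha z hz
    obtain ⟨s, hst, rfl, h⟩ := (hr₁ z).1 (by simp [hz])
    by_contra hc
    rcases (not_lt.1 hc).eq_or_lt with h2 | h2
    · have := congrArg p (Nat.succ.inj h2)
      rw [hinv, hinv] at this; omega
    · refine hav (p t) (p s) t (by omega) (by omega) ?_
      rw [hinv, hinv]
      omega
  have hI : insertInTableau (p t + 1) ((a ++ (t + 1) :: b) :: singleRow r₂) =
      ((a ++ (p t + 1) :: b) :: singleRow (r₂ ++ [t + 1]), 1) := by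
    have h2 := insertInTableau_singleRow (x := t + 1) (r := r₂)
      fun y hy => (hr₂ y hy).trans (by omega)
    simp [insertInTableau, insertInRow_append_cons (fun z hz => (ha' z hz).le)
      (show p t + 1 < t + 1 by omega), h2]
  refine ⟨a ++ (p t + 1) :: b, r₂ ++ [t + 1], q₁, q₂ ++ [t + 1], ?_, ?_, ?_, ?_, ?_⟩
  · rw [hI]
    simp [addBox, addBox_zero_singleRow]
  · rw [List.pairwise_append, List.pairwise_cons]
    refine ⟨hs'.1, ⟨fun z hz => ?_, (List.pairwise_cons.1 hs'.2.1).2⟩, ?_⟩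
    · have := hb z hz; omega
    · intro z hz y hy
      rcases List.mem_cons.1 hy with rfl | hy
      · exact ha' z hz
      · have := ha z hz
        have := hb y hy
        omega
  · intro x
    have hx : x ∈ a ++ (p t + 1) :: b ↔ (x ∈ a ++ (t + 1) :: b ∧ x ≠ t + 1) ∨ x = p t + 1 := by
      simp only [List.mem_append, List.mem_cons]
      have h1 := ha x
      have h2 := hb x
      constructor
      · rintro (h | h | h)
        · exact Or.inl ⟨Or.inl h, (h1 h).ne⟩
        · exact Or.inr h
        · exact Or.inl ⟨Or.inr (Or.inr h), (h2 h).ne'⟩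
      · tauto
    rw [hx, hr₁]
    constructor
    · rintro (⟨⟨s, hst, rfl, h⟩, hne⟩ | rfl)
      · exact ⟨s, by omega, rfl, by omega⟩
      · exact ⟨t, by omega, rfl, by omega⟩
    · rintro ⟨s, hst, rfl, h⟩
      rcases (Nat.lt_succ_iff.1 hst).eq_or_lt with rfl | h1
      · exact Or.inr rfl
      · exact Or.inl ⟨⟨s, h1, rfl, by omega⟩, by omega⟩
  · intro x hx
    rw [List.mem_append, List.mem_singleton] at hx
    rcases hx with hx | rfl
    · have := hr₂ x hx; omega
    · exact le_rfl
  · intro x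
    rw [hq₁]
    constructor
    · rintro ⟨s, hst, h, rfl⟩
      exact ⟨s, by omega, h, rfl⟩
    · rintro ⟨s, hst, h, rfl⟩
      rcases (Nat.lt_succ_iff.1 hst).eq_or_lt with rfl | h1
      · omega
      · exact ⟨s, h1, h, rfl⟩

lemma isPartialPair_rsFrom (hinv : ∀ s, p (p s) = s)
    (hav : ∀ a b c, a < b → b < c → ¬ (p b < p a ∧ p c < p b)) (t : ℕ) :
    IsPartialPair p (t + 1)
      (rsFrom 1 ([], []) ((List.range (t + 1)).map fun s => p s + 1)) := by
  induction t with
  | zero =>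
    refine ⟨[p 0 + 1], [], [1], [], by simp [rsFrom, insertInTableau, addBox, singleRow],
      by simp, fun x => ?_, by simp, by simp⟩
    have : 1 ≤ p 0 ∨ p 0 = 0 := by omega
    simp [this]
  | succ t ih =>
    rw [List.range_succ, List.map_append, rsFrom_append]
    simp only [List.length_map, List.length_range, List.map_cons, List.map_nil, rsFrom]
    rw [show 1 + (t + 1) = t + 1 + 1 by omega]
    rcases le_or_gt (t + 1) (p (t + 1)) with h | h
    · exact ih.step_of_le hinv hav h
    · exact ih.step_of_lt hinv hav h

lemma mem_first_row_iff (hinv : ∀ s, p (p s) = s)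
    (hav : ∀ a b c, a < b → b < c → ¬ (p b < p a ∧ p c < p b)) {n t : ℕ} (ht : t < n) :
    t + 1 ∈ (rsFrom 1 ([], []) ((List.range n).map fun s => p s + 1)).2.getD 0 [] ↔
      t ≤ p t := by
  obtain ⟨n, rfl⟩ : ∃ m, n = m + 1 := ⟨n - 1, by omega⟩
  obtain ⟨r₁, r₂, q₁, q₂, h, -, -, -, hq₁⟩ := isPartialPair_rsFrom hinv hav n
  rw [h]
  simp only [List.getD_cons_zero, hq₁]
  constructor
  · rintro ⟨s, hs, h, h'⟩
    obtain rfl := Nat.succ.inj h'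
    exact h
  · exact fun h => ⟨t, ht, h, rfl⟩

end

/-! ### The map `ρ` -/

/-- The permutation `π` as a map of `ℕ` that fixes every `s ≥ n`. -/
def natMap {n : ℕ} (π : Equiv.Perm (Fin n)) (s : ℕ) : ℕ :=
  if h : s < n then (π ⟨s, h⟩ : ℕ) else s

section
variable {n : ℕ} {π : Equiv.Perm (Fin n)}

lemma natMap_val (π : Equiv.Perm (Fin n)) (i : Fin n) : natMap π i = π i := by
  simp [natMap]

lemma natMap_lt (π : Equiv.Perm (Fin n)) {s : ℕ} (hs : s < n) : natMap π s < n := by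
  simp [natMap, hs]

lemma natMap_natMap (hπ : π ∈ involutions321 n) (s : ℕ) : natMap π (natMap π s) = s := by
  unfold natMap
  by_cases h : s < n
  · have h2 : π (π ⟨s, h⟩) = ⟨s, h⟩ := by
      rw [← Equiv.Perm.eq_inv_iff_eq, hπ.1]
    simp [h, h2]
  · simp [h]

lemma natMap_avoids (hπ : π ∈ involutions321 n) (a b c : ℕ) (hab : a < b) (hbc : b < c) :
    ¬ (natMap π b < natMap π a ∧ natMap π c < natMap π b) := by
  rintro ⟨h1, h2⟩
  by_cases hc : c < n
  · have := hπ.2 ⟨a, by omega⟩ ⟨b, by omega⟩ ⟨c, hc⟩ hab hbc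
    simp only [natMap, hc, hbc.trans hc, hab.trans (hbc.trans hc), dif_pos] at h1 h2
    exact this ⟨h1, h2⟩
  · have h3 : natMap π c = c := by simp [natMap, hc]
    by_cases hb : b < n
    · have := natMap_lt π hb
      omega
    · have h4 : natMap π b = b := by simp [natMap, hb]
      omega

lemma length_rho (π : Equiv.Perm (Fin n)) : (rho π).length = n := by simp [rho]

lemma rho_getElem? (hπ : π ∈ involutions321 n) {t : ℕ} (ht : t < n) :
    (rho π)[t]? = some (if t ≤ natMap π t then Step.N else Step.E) := by
  have hw : (List.ofFn fun i => (π i : ℕ) + 1) = (List.range n).map fun s => natMap π s + 1 := by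
    apply List.ext_getElem
    · simp
    · intro i h1 h2
      simp at h1
      simp [natMap, h1]
  have := mem_first_row_iff (natMap_natMap hπ) (natMap_avoids hπ) ht
  unfold rho robinsonSchensted
  rw [hw, List.getElem?_map, List.getElem?_range ht]
  simp only [Option.map_some, this]

lemma rho_getElem?_eq_N (hπ : π ∈ involutions321 n) {t : ℕ} (ht : t < n) :
    (rho π)[t]? = some Step.N ↔ t ≤ natMap π t := by
  rw [rho_getElem? hπ ht]; split_ifs with h <;> simp [h]

lemma rho_getElem?_eq_E (hπ : π ∈ involutions321 n) {t : ℕ} (ht : t < n) :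
    (rho π)[t]? = some Step.E ↔ natMap π t < t := by
  rw [rho_getElem? hπ ht]; split_ifs with h <;> simp [h]; omega

/-! ### Dyck path prefixes and injectivity of `ρ`. -/

/-- The involution itself sends the `E` steps injectively to earlier `N` steps. -/
lemma rho_mapsTo (n : ℕ) : Set.MapsTo (rho (n := n)) (involutions321 n) (dyckPrefixes n) := by
  intro π hπ
  refine ⟨length_rho π, fun i hi => ?_⟩
  rw [length_rho] at hi
  rw [count_take_eq_card, count_take_eq_card]
  have hinj : Function.Injective (natMap π) :=
    Function.LeftInverse.injective (g := natMap π) (natMap_natMap hπ)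
  refine Finset.card_le_card_of_injOn (natMap π) (fun s hs => ?_) hinj.injOn
  simp only [Finset.coe_filter, Finset.mem_range, Set.mem_ofPred_eq] at hs ⊢
  have h1 := (rho_getElem?_eq_E hπ (by omega)).1 hs.2
  refine ⟨by omega, ?_⟩
  rw [rho_getElem?_eq_N hπ (by omega), natMap_natMap hπ]
  exact h1.le

/-- If `σ o' = π o = t`, while `π` and `σ` agree on larger arguments than `t`, then `o'` cannot be
larger than `o`. -/
lemma natMap_le_of_agree {σ : Equiv.Perm (Fin n)} (hπ : π ∈ involutions321 n)
    (hσ : σ ∈ involutions321 n) (h : rho π = rho σ) {t : ℕ} (ht : t < n)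
    (hag : ∀ s, t < s → natMap π s = natMap σ s) (hσt : natMap σ t < t) :
    natMap σ t ≤ natMap π t := by
  by_contra hc
  have h1 : natMap σ t ≤ natMap π (natMap σ t) := by
    rw [← rho_getElem?_eq_N hπ (by omega), h, rho_getElem?_eq_N hσ (by omega),
      natMap_natMap hσ]
    exact hσt.le
  rcases lt_trichotomy (natMap π (natMap σ t)) t with h2 | h2 | h2
  -- With `o = π t < o' = σ t < t`, the values `t > π o' > o` at the positions `o, o', t` form a
  -- 321.
  · refine natMap_avoids hπ (natMap π t) (natMap σ t) t (by omega) hσt ?_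
    rw [natMap_natMap hπ]
    omega
  · have := natMap_natMap hπ (natMap σ t)
    rw [h2] at this; omega
  · have h3 := hag _ h2
    rw [natMap_natMap hπ] at h3
    have h4 := congrArg (natMap σ) h3
    rw [natMap_natMap hσ, natMap_natMap hσ] at h4
    omega

/-- Downward induction on the argument. A strict excedance at `t` is read off from its image above
`t`, where the permutations already agree; at a deficiency, `natMap_le_of_agree` applies in both
directions. -/
lemma rho_injOn (n : ℕ) : Set.InjOn (rho (n := n)) (involutions321 n) := by
  intro π hπ σ hσ h
  have key : ∀ k s : ℕ, n ≤ s + k → natMap π s = natMap σ s := by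
    intro k
    induction k with
    | zero => intro s hs; simp [natMap, show ¬ s < n by omega]
    | succ k ih =>
      intro t ht'
      rcases Nat.lt_or_ge t n with ht | ht
      swap
      · simp [natMap, show ¬ t < n by omega]
      have hag : ∀ s, t < s → natMap π s = natMap σ s := fun s hs => ih s (by omega)
      have hiff : t ≤ natMap π t ↔ t ≤ natMap σ t := by
        rw [← rho_getElem?_eq_N hπ ht, h, rho_getElem?_eq_N hσ ht]
      rcases Nat.lt_or_ge (natMap π t) t with h1 | h1
      · have h2 : natMap σ t < t := by omega
        exact le_antisymm (natMap_le_of_agree hσ hπ h.symm ht (fun s hs => (hag s hs).symm) h1)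
          (natMap_le_of_agree hπ hσ h ht hag h2)
      · have h2 := hiff.1 h1
        rcases h1.eq_or_lt with h3 | h3
        · rcases h2.eq_or_lt with h4 | h4
          · omega
          · have := hag _ h4
            rw [natMap_natMap hσ] at this
            have := congrArg (natMap π) this
            rw [natMap_natMap hπ] at this
            omega
        · have := hag _ h3
          rw [natMap_natMap hπ] at this
          have := congrArg (natMap σ) this
          rw [natMap_natMap hσ] at this
          exact this.symm
  ext i
  have := key n i (by omega)
  rwa [natMap_val, natMap_val] at this

/-! ### Surjectivity of `ρ`. -/

/-- Facing pairs cannot serve as the 2-cycles of the involution, since nested pairs create a 321;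
the order isomorphism is used instead. -/
lemma exists_increasing_matching {S T : Finset ℕ} (h : S.card = T.card) :
    ∃ f g : ℕ → ℕ, (∀ x ∈ S, f x ∈ T ∧ g (f x) = x) ∧ (∀ y ∈ T, g y ∈ S ∧ f (g y) = y) ∧
      (∀ x ∈ S, ∀ x' ∈ S, x < x' → f x < f x') ∧ ∀ y ∈ T, ∀ y' ∈ T, y < y' → g y < g y' := by
  let e : S ≃o T := (S.orderIsoOfFin rfl).symm.trans (T.orderIsoOfFin h.symm)
  refine ⟨fun x => if hx : x ∈ S then e ⟨x, hx⟩ else 0,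
    fun y => if hy : y ∈ T then e.symm ⟨y, hy⟩ else 0, ?_, ?_, ?_, ?_⟩
  · intro x hx; simp [hx]
  · intro y hy; simp [hy]
  · intro x hx x' hx' hlt
    simp only [hx, hx', dif_pos]
    exact e.strictMono (a := ⟨x, hx⟩) (b := ⟨x', hx'⟩) hlt
  · intro x hx x' hx' hlt
    simp only [hx, hx', dif_pos]
    exact e.symm.strictMono (a := ⟨x, hx⟩) (b := ⟨x', hx'⟩) hlt

lemma card_filter_lt_eq {S T : Finset ℕ} {f g : ℕ → ℕ} (hf : ∀ x ∈ S, f x ∈ T ∧ g (f x) = x)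
    (hg : ∀ y ∈ T, g y ∈ S ∧ f (g y) = y) (hfm : ∀ x ∈ S, ∀ x' ∈ S, x < x' → f x < f x')
    (hgm : ∀ y ∈ T, ∀ y' ∈ T, y < y' → g y < g y') {x : ℕ} (hx : x ∈ S) :
    (S.filter (· < x)).card = (T.filter (· < f x)).card := by
  refine Finset.card_nbij' f g ?_ ?_ ?_ ?_
  · intro y hy
    simp only [Finset.coe_filter, Set.mem_ofPred_eq] at hy ⊢
    exact ⟨(hf y hy.1).1, hfm _ hy.1 _ hx hy.2⟩
  · intro y hy
    simp only [Finset.coe_filter, Set.mem_ofPred_eq] at hy ⊢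
    refine ⟨(hg y hy.1).1, ?_⟩
    have := hgm _ hy.1 _ (hf x hx).1 hy.2
    rwa [(hf x hx).2] at this
  · intro y hy
    simp only [Finset.coe_filter, Set.mem_ofPred_eq] at hy
    exact (hf y hy.1).2
  · intro y hy
    simp only [Finset.coe_filter, Set.mem_ofPred_eq] at hy
    exact (hg y hy.1).2

/-- Every Dyck path prefix is the sequence of weak excedances (`N`) and deficiencies (`E`) of a
`321`-avoiding involution. -/
lemma exists_involution_of_staysAbove {w : List Step} (hw : StaysAbove w) :
    ∃ p : ℕ → ℕ, (∀ s, p (p s) = s) ∧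
      (∀ a b c, a < b → b < c → ¬ (p b < p a ∧ p c < p b)) ∧
      (∀ s < w.length, p s < w.length) ∧
      ∀ s < w.length, w[s]? = some Step.E ↔ p s < s := by
  rw [staysAbove_iff_unmatched] at hw
  set n := w.length with hn
  set S := (Finset.range n).filter fun p => w[p]? = some Step.N ∧ p ∉ unmatched w with hS
  set T := (Finset.range n).filter fun p => w[p]? = some Step.E ∧ p ∉ unmatched w with hT
  have hcut : ∀ (s : Step) (i : ℕ), i ≤ n →
      ((Finset.range n).filter fun p => w[p]? = some s ∧ p ∉ unmatched w).filter (· < i) =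
      (Finset.range i).filter fun p => w[p]? = some s ∧ p ∉ unmatched w := by
    intro s i hi
    ext x
    simp only [Finset.mem_filter, Finset.mem_range]
    constructor
    · rintro ⟨⟨h1, h2⟩, h3⟩; exact ⟨h3, h2⟩
    · rintro ⟨h1, h2⟩; exact ⟨⟨by omega, h2⟩, h1⟩
  have hcard : S.card = T.card :=
    card_matched_N_eq_card_matched_E fun p q h _ => h.lt_length
  obtain ⟨f, g, hf, hg, hfm, hgm⟩ := exists_increasing_matching hcard
  have hSn : ∀ x ∈ S, x < n := fun x hx => by simp [hS] at hx; exact hx.1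
  have hTn : ∀ x ∈ T, x < n := fun x hx => by simp [hT] at hx; exact hx.1
  have hdisj : ∀ x ∈ S, x ∉ T := fun x hx hx' => by
    simp only [hS, hT, Finset.mem_filter] at hx hx'
    rw [hx.2.1] at hx'; simp at hx'
  have hflt : ∀ x ∈ S, x < f x := by
    intro x hx
    by_contra hc
    have hfx := (hf x hx).1
    have hlt : f x < x := lt_of_le_of_ne (not_lt.1 hc) fun h => hdisj x hx (h ▸ hfx)
    have hfn := hTn _ hfx
    have h1 := card_filter_lt_eq hf hg hfm hgm hx
    -- If `f x < x`, the elements of `T` up to and including `f x` would be at most as many as the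
    -- elements of `S` below `f x`, while `x` and `f x` have equal ranks in `S` and `T`.
    have h2 := card_E_le_card_N w (f x + 1)
    rw [Nat.add_sub_cancel, ← hcut Step.E (f x + 1) hfn, ← hcut Step.N (f x) hfn.le, ← hS,
      ← hT] at h2
    have h3 : (T.filter (· < f x)).card < (T.filter (· < f x + 1)).card := by
      refine Finset.card_lt_card (Finset.ssubset_iff_subset_ne.2 ⟨fun y hy => ?_, fun h => ?_⟩)
      · simp only [Finset.mem_filter] at hy ⊢
        exact ⟨hy.1, by omega⟩
      · have := Finset.ext_iff.1 h (f x)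
        simp [hfx] at this
    have h4 : (S.filter (· < f x)).card ≤ (S.filter (· < x)).card := by
      refine Finset.card_le_card fun y hy => ?_
      simp only [Finset.mem_filter] at hy ⊢
      exact ⟨hy.1, by omega⟩
    omega
  have hU : ∀ u, u < n → u ∉ S → u ∉ T → ∀ x ∈ S, x < u → f x < u := by
    intro u hu huS huT x hx hxu
    by_contra hc
    have hum : u ∈ unmatched w := by
      by_contra hum
      rcases step_cases hu with h | h
      · exact huS (by simp [hS, hu, h, hum])
      · exact huT (by simp [hT, hu, h, hum])
    have h1 := card_filter_lt_eq hf hg hfm hgm hx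
    -- An unmatched step separates no facing pair, so `S` and `T` have equally many elements below
    -- `u`, and the rank-preserving `f` cannot carry `x` across `u`.
    have h2 := card_matched_N_eq_card_matched_E (w := w) (i := u) fun p q h hp => by
      by_contra hc
      exact h.between_notMem hp.le (not_lt.1 hc) hum
    rw [← hcut Step.N u hu.le, ← hcut Step.E u hu.le, ← hS, ← hT] at h2
    have h3 : (T.filter (· < u)).card ≤ (T.filter (· < f x)).card := by
      refine Finset.card_le_card fun y hy => ?_
      simp only [Finset.mem_filter] at hy ⊢
      exact ⟨hy.1, by omega⟩
    have h4 : (S.filter (· < x)).card < (S.filter (· < u)).card := by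
      refine Finset.card_lt_card (Finset.ssubset_iff_subset_ne.2 ⟨fun y hy => ?_, fun h => ?_⟩)
      · simp only [Finset.mem_filter] at hy ⊢
        exact ⟨hy.1, by omega⟩
      · have := Finset.ext_iff.1 h x
        simp [hx, hxu] at this
    omega
  set p : ℕ → ℕ := fun x => if x ∈ S then f x else if x ∈ T then g x else x with hp
  have hpS : ∀ x ∈ S, p x = f x := fun x hx => by simp [hp, hx]
  have hpT : ∀ x ∈ T, p x = g x := fun x hx => by
    have : x ∉ S := fun h => hdisj x h hx
    simp [hp, hx, this]
  have hpU : ∀ x, x ∉ S → x ∉ T → p x = x := fun x h1 h2 => by simp [hp, h1, h2]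
  have hglt : ∀ y ∈ T, g y < y := fun y hy => by
    have := hflt _ (hg y hy).1
    rwa [(hg y hy).2] at this
  -- Being increasing off `T` and on `T` excludes 321: two of any three positions lie on the same
  -- side.
  have hmono : ∀ a b, a < b → a ∉ T → b ∉ T → p a < p b := by
    intro a b hab ha hb
    by_cases ha' : a ∈ S <;> by_cases hb' : b ∈ S
    · rw [hpS a ha', hpS b hb']; exact hfm a ha' b hb' hab
    · rw [hpS a ha', hpU b hb' hb]
      by_cases hbn : b < n
      · exact hU b hbn hb' hb a ha' hab
      · have := hTn _ (hf a ha').1; omega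
    · rw [hpU a ha' ha, hpS b hb']; have := hflt b hb'; omega
    · rw [hpU a ha' ha, hpU b hb' hb]; exact hab
  have hmonoT : ∀ a b, a < b → a ∈ T → b ∈ T → p a < p b := by
    intro a b hab ha hb
    rw [hpT a ha, hpT b hb]; exact hgm a ha b hb hab
  refine ⟨p, fun s => ?_, ?_, fun s hs => ?_, fun s hs => ?_⟩
  · by_cases h1 : s ∈ S
    · rw [hpS s h1, hpT _ (hf s h1).1, (hf s h1).2]
    · by_cases h2 : s ∈ T
      · rw [hpT s h2, hpS _ (hg s h2).1, (hg s h2).2]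
      · rw [hpU s h1 h2, hpU s h1 h2]
  · rintro a b c hab hbc ⟨h1, h2⟩
    have m1 := hmono a b hab
    have m2 := hmono b c hbc
    have m3 := hmono a c (hab.trans hbc)
    have m4 := hmonoT a b hab
    have m5 := hmonoT b c hbc
    have m6 := hmonoT a c (hab.trans hbc)
    by_cases ha : a ∈ T <;> by_cases hb : b ∈ T <;> by_cases hc : c ∈ T <;>
      simp only [ha, hb, hc, not_true_eq_false, not_false_eq_true,
        forall_const] at m1 m2 m3 m4 m5 m6 <;>
      omega
  · by_cases h1 : s ∈ S
    · rw [hpS s h1]; exact hTn _ (hf s h1).1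
    · by_cases h2 : s ∈ T
      · rw [hpT s h2]; exact hSn _ (hg s h2).1
      · rwa [hpU s h1 h2]
  · by_cases h1 : s ∈ S
    · have h2 := hflt s h1
      rw [hpS s h1]
      simp only [hS, Finset.mem_filter] at h1
      simp [h1.2.1]; omega
    · by_cases h2 : s ∈ T
      · have h3 := hglt s h2
        rw [hpT s h2]
        simp only [hT, Finset.mem_filter] at h2
        simp [h2.2.1, h3]
      · rw [hpU s h1 h2]
        refine iff_of_false (fun h => h2 ?_) (lt_irrefl s)
        have : s ∉ unmatched w := fun hs' => by
          have := hw s hs'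
          rw [h] at this; cases this
        simp [hT, hs, h, this]

lemma rho_surjOn (n : ℕ) : Set.SurjOn (rho (n := n)) (involutions321 n) (dyckPrefixes n) := by
  rintro w ⟨rfl, hw⟩
  obtain ⟨p, hinv, hav, hlt, hE⟩ := exists_involution_of_staysAbove hw
  let F : Fin w.length → Fin w.length := fun i => ⟨p i, hlt i i.2⟩
  have hF : Function.Involutive F := fun i => Fin.ext (hinv i)
  have hmem : hF.toPerm F ∈ involutions321 w.length := by
    refine ⟨?_, fun i j k hij hjk h => hav i j k hij hjk h⟩
    rw [inv_eq_iff_mul_eq_one]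
    ext i
    simp [hF i]
  refine ⟨hF.toPerm F, hmem, ext_steps (length_rho _) fun t => ?_⟩
  by_cases ht : t < w.length
  · rw [rho_getElem?_eq_E hmem ht, hE t ht]
    simp [natMap, ht, F]
  · rw [List.getElem?_eq_none (by rw [length_rho]; omega), List.getElem?_eq_none (by omega)]

lemma rho_bijOn (n : ℕ) : Set.BijOn (rho (n := n)) (involutions321 n) (dyckPrefixes n) :=
  ⟨rho_mapsTo n, rho_injOn n, rho_surjOn n⟩

/-! ### Descents are peaks. -/

/-- An inversion within one class extends to a 321: by the later position `π a` for weak excedances,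
by the earlier position `π b` for deficiencies. -/
lemma natMap_lt_of_lt (hπ : π ∈ involutions321 n) {a b : ℕ} (hab : a < b)
    (h : natMap π a < a ↔ natMap π b < b) : natMap π a < natMap π b := by
  by_contra hc
  have hne : natMap π b ≠ natMap π a := fun h => by
    have := congrArg (natMap π) h
    rw [natMap_natMap hπ, natMap_natMap hπ] at this
    omega
  have hlt : natMap π b < natMap π a := by omega
  by_cases ha : natMap π a < a
  · refine natMap_avoids hπ (natMap π b) (natMap π a) b hlt (by omega) ?_
    rw [natMap_natMap hπ, natMap_natMap hπ]
    omega
  · refine natMap_avoids hπ a b (natMap π a) hab (by omega) ⟨hlt, ?_⟩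
    rw [natMap_natMap hπ]
    omega

lemma descentSet_eq_peakPositions (hπ : π ∈ involutions321 n) :
    descentSet π = peakPositions (rho π) := by
  ext x
  simp only [descentSet, peakPositions, Finset.mem_image, Finset.mem_filter, Finset.mem_univ,
    true_and, Finset.mem_range, length_rho]
  constructor
  · rintro ⟨i, ⟨h, hd⟩, rfl⟩
    refine ⟨i, ⟨i.2, ?_⟩, rfl⟩
    rw [rho_getElem?_eq_N hπ i.2, rho_getElem?_eq_E hπ h]
    have h1 : natMap π i = π i := natMap_val π i
    have h2 : natMap π (i + 1) = π ⟨i + 1, h⟩ := natMap_val π ⟨i + 1, h⟩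
    have h3 : natMap π (i + 1) < natMap π i := by rw [h1, h2]; exact hd
    have h4 := fun h => natMap_lt_of_lt hπ (Nat.lt_succ_self (i : ℕ)) h
    simp only [Nat.succ_eq_add_one] at h4
    by_contra hc
    by_cases h5 : natMap π i < i
    · by_cases h6 : natMap π (i + 1) < i + 1
      · have := h4 (by tauto); omega
      · omega
    · by_cases h6 : natMap π (i + 1) < i + 1
      · exact hc ⟨not_lt.1 h5, h6⟩
      · have := h4 (by tauto); omega
  · rintro ⟨i, ⟨hi, hN, hE⟩, rfl⟩
    have h := lt_length_of_getElem? hE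
    rw [length_rho] at h
    rw [rho_getElem?_eq_N hπ hi] at hN
    rw [rho_getElem?_eq_E hπ h] at hE
    have h1 : natMap π i = π ⟨i, hi⟩ := natMap_val π ⟨i, hi⟩
    have h2 : natMap π (i + 1) = π ⟨i + 1, h⟩ := natMap_val π ⟨i + 1, h⟩
    have hne : natMap π i ≠ natMap π (i + 1) := fun h => by
      have := congrArg (natMap π) h
      rw [natMap_natMap hπ, natMap_natMap hπ] at this
      omega
    refine ⟨⟨i, hi⟩, ⟨h, ?_⟩, rfl⟩
    rw [Fin.lt_def, ← h1, ← h2]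
    omega

end

/-! ### Paths are determined by their peaks -/

lemma mem_peakCoords {w : List Step} {c : ℕ × ℕ} :
    c ∈ peakCoords w ↔ ∃ p, w[p]? = some Step.N ∧ w[p + 1]? = some Step.E ∧
      ((w.take (p + 1)).count Step.E, (w.take (p + 1)).count Step.N) = c := by
  simp only [peakCoords, Finset.mem_image, Finset.mem_filter, Finset.mem_range, and_assoc]
  exact exists_congr fun p => ⟨fun h => h.2, fun h => ⟨lt_length_of_getElem? h.1, h⟩⟩

lemma mem_peakCoords_E_cons {w : List Step} {c : ℕ × ℕ} :
    c ∈ peakCoords (Step.E :: w) ↔ ∃ d ∈ peakCoords w, c = (d.1 + 1, d.2) := by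
  simp only [mem_peakCoords]
  constructor
  · rintro ⟨p, h1, h2, rfl⟩
    cases p with
    | zero => simp at h1
    | succ p =>
      simp only [List.getElem?_cons_succ] at h1 h2
      exact ⟨_, ⟨p, h1, h2, rfl⟩, by simp⟩
  · rintro ⟨_, ⟨p, h1, h2, rfl⟩, rfl⟩
    exact ⟨p + 1, by simpa using h1, by simpa using h2, by simp⟩

lemma mem_peakCoords_N_cons {w : List Step} {c : ℕ × ℕ} :
    c ∈ peakCoords (Step.N :: w) ↔
      (w[0]? = some Step.E ∧ c = (0, 1)) ∨ ∃ d ∈ peakCoords w, c = (d.1, d.2 + 1) := by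
  simp only [mem_peakCoords]
  constructor
  · rintro ⟨p, h1, h2, rfl⟩
    cases p with
    | zero => exact Or.inl ⟨by simpa using h2, by simp⟩
    | succ p =>
      simp only [List.getElem?_cons_succ] at h1 h2
      exact Or.inr ⟨_, ⟨p, h1, h2, rfl⟩, by simp⟩
  · rintro (⟨h, rfl⟩ | ⟨_, ⟨p, h1, h2, rfl⟩, rfl⟩)
    · exact ⟨0, by simp, by simpa using h, by simp⟩
    · exact ⟨p + 1, by simpa using h1, by simpa using h2, by simp⟩

lemma one_le_snd_of_mem_peakCoords {w : List Step} {c : ℕ × ℕ} (h : c ∈ peakCoords w) :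
    1 ≤ c.2 := by
  obtain ⟨p, h1, -, rfl⟩ := mem_peakCoords.1 h
  simp [count_take_succ h1]

lemma exists_peak_of_N_cons {w : List Step} (h : 0 < w.count Step.E) :
    ∃ y, (0, y) ∈ peakCoords (Step.N :: w) := by
  induction w with
  | nil => simp at h
  | cons s w ih =>
    cases s with
    | E => exact ⟨1, mem_peakCoords_N_cons.2 (Or.inl ⟨by simp, rfl⟩)⟩
    | N =>
      obtain ⟨y, hy⟩ := ih (by simpa using h)
      exact ⟨y + 1, mem_peakCoords_N_cons.2 (Or.inr ⟨_, hy, rfl⟩)⟩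

lemma peakCoords_N_cons_ne_E_cons {u v : List Step}
    (hE : (Step.N :: u).count Step.E = (Step.E :: v).count Step.E) :
    peakCoords (Step.N :: u) ≠ peakCoords (Step.E :: v) := by
  intro h
  obtain ⟨y, hy⟩ := exists_peak_of_N_cons (w := u) (by simp at hE; omega)
  rw [h] at hy
  obtain ⟨d, -, hd⟩ := mem_peakCoords_E_cons.1 hy
  simp at hd

/-- As long as an `E` step remains, the path starts with `N` exactly when it has a peak on the line
`x = 0`. So the peaks reveal the first step, and the tails are compared after a shift. -/
lemma eq_of_peakCoords_eq {u v : List Step} (hE : u.count Step.E = v.count Step.E)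
    (hN : u.count Step.N = v.count Step.N) (h : peakCoords u = peakCoords v) : u = v := by
  induction u generalizing v with
  | nil =>
    have := count_N_add_count_E v
    rw [← hE, ← hN] at this
    exact (List.length_eq_zero_iff.1 (by simpa using this.symm)).symm
  | cons s u ih =>
    cases v with
    | nil =>
      have := count_N_add_count_E (s :: u)
      rw [hE, hN] at this
      simp at this
    | cons t v =>
      cases s <;> cases t
      · refine congrArg _ (ih (by simpa using hE) (by simpa using hN) ?_)
        ext d
        have hd := Finset.ext_iff.1 h (d.1, d.2 + 1)
        rw [mem_peakCoords_N_cons, mem_peakCoords_N_cons] at hd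
        -- The leading `N` can create the peak `(0, 1)`, which would correspond to `d.2 = 0`; the
        -- condition `1 ≤ d.2` discards it.
        have key : ∀ w : List Step, d ∈ peakCoords w ↔
            ((w[0]? = some Step.E ∧ (d.1, d.2 + 1) = (0, 1)) ∨
              ∃ c ∈ peakCoords w, (d.1, d.2 + 1) = (c.1, c.2 + 1)) ∧ 1 ≤ d.2 := by
          intro w
          constructor
          · exact fun hw => ⟨Or.inr ⟨d, hw, rfl⟩, one_le_snd_of_mem_peakCoords hw⟩
          · rintro ⟨⟨-, h⟩ | ⟨c, hc, h⟩, h'⟩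
            · simp at h; omega
            · simp only [Prod.mk.injEq, Nat.add_right_cancel_iff] at h
              rwa [show d = c from Prod.ext h.1 h.2]
        rw [key, key, hd]
      · exact absurd h (peakCoords_N_cons_ne_E_cons hE)
      · exact absurd h.symm (peakCoords_N_cons_ne_E_cons hE.symm)
      · refine congrArg _ (ih (by simpa using hE) (by simpa using hN) ?_)
        ext d
        have hd := Finset.ext_iff.1 h (d.1 + 1, d.2)
        rw [mem_peakCoords_E_cons, mem_peakCoords_E_cons] at hd
        have key : ∀ w : List Step, d ∈ peakCoords w ↔
            ∃ c ∈ peakCoords w, (d.1 + 1, d.2) = (c.1 + 1, c.2) := by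
          intro w
          constructor
          · exact fun hw => ⟨d, hw, rfl⟩
          · rintro ⟨c, hc, h⟩
            simp only [Prod.mk.injEq, Nat.add_right_cancel_iff] at h
            rwa [show d = c from Prod.ext h.1 h.2]
        rw [key, key, hd]

lemma mem_peakCoords_replicate_E_append {a : ℕ} {w : List Step} {c : ℕ × ℕ} :
    c ∈ peakCoords (List.replicate a Step.E ++ w) ↔
      ∃ d ∈ peakCoords w, c = (a + d.1, d.2) := by
  induction a generalizing c with
  | zero => simp
  | succ a ih =>
    rw [List.replicate_succ, List.cons_append, mem_peakCoords_E_cons]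
    constructor
    · rintro ⟨d, hd, rfl⟩
      obtain ⟨e, he, rfl⟩ := ih.1 hd
      exact ⟨e, he, by ext <;> simp; omega⟩
    · rintro ⟨d, hd, rfl⟩
      exact ⟨_, ih.2 ⟨d, hd, rfl⟩, by ext <;> simp; omega⟩

lemma mem_peakCoords_replicate_N_append_E_cons {b : ℕ} {w : List Step} {c : ℕ × ℕ} :
    c ∈ peakCoords (List.replicate (b + 1) Step.N ++ Step.E :: w) ↔
      c = (0, b + 1) ∨ ∃ d ∈ peakCoords w, c = (d.1 + 1, b + 1 + d.2) := by
  induction b generalizing c with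
  | zero =>
    simp only [zero_add, List.replicate_one, List.singleton_append, mem_peakCoords_N_cons,
      mem_peakCoords_E_cons]
    simp only [List.getElem?_cons_zero, true_and]
    refine or_congr_right ⟨?_, ?_⟩
    · rintro ⟨_, ⟨d, hd, rfl⟩, rfl⟩
      exact ⟨d, hd, by ext <;> simp; omega⟩
    · rintro ⟨d, hd, rfl⟩
      exact ⟨_, ⟨d, hd, rfl⟩, by ext <;> simp; omega⟩
  | succ b ih =>
    rw [List.replicate_succ, List.cons_append, mem_peakCoords_N_cons]
    constructor
    · rintro (⟨h, -⟩ | ⟨d, hd, rfl⟩)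
      · simp [List.replicate_succ] at h
      · rcases ih.1 hd with rfl | ⟨e, he, rfl⟩
        · exact Or.inl rfl
        · exact Or.inr ⟨e, he, by ext <;> simp; omega⟩
    · rintro (rfl | ⟨d, hd, rfl⟩)
      · exact Or.inr ⟨_, ih.2 (Or.inl rfl), rfl⟩
      · exact Or.inr ⟨_, ih.2 (Or.inr ⟨d, hd, rfl⟩), by ext <;> simp; omega⟩

lemma peakCoords_replicate_N (b : ℕ) : peakCoords (List.replicate b Step.N) = ∅ := by
  refine Finset.eq_empty_of_forall_notMem fun c hc => ?_
  obtain ⟨p, -, h, -⟩ := mem_peakCoords.1 hc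
  rw [List.getElem?_replicate] at h
  split_ifs at h
  cases h

/-- A chain of points is the set of peaks of a path with prescribed end point; the path starts at
`(x₀, y₀)`. -/
lemma exists_path_with_peaks (l : List (ℕ × ℕ)) (x₀ y₀ C R : ℕ)
    (hl : l.Pairwise fun a b => a.1 < b.1 ∧ a.2 < b.2)
    (hb : ∀ c ∈ l, x₀ ≤ c.1 ∧ c.1 < x₀ + C ∧ y₀ < c.2 ∧ c.2 ≤ y₀ + R) :
    ∃ G : List Step, G.count Step.E = C ∧ G.count Step.N = R ∧
      ∀ c, c ∈ l ↔ ∃ d ∈ peakCoords G, c = (x₀ + d.1, y₀ + d.2) := by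
  induction l generalizing x₀ y₀ C R with
  | nil =>
    -- With no peak left to make, all `E` steps must precede all `N` steps.
    refine ⟨List.replicate C Step.E ++ List.replicate R Step.N, ?_, ?_, fun c => ?_⟩
    · simp [List.count_replicate]
    · simp [List.count_replicate]
    · simp only [mem_peakCoords_replicate_E_append, peakCoords_replicate_N]
      simp
  | cons a l ih =>
    obtain ⟨x, y⟩ := a
    have h0 := hb (x, y) (by simp)
    rw [List.pairwise_cons] at hl
    simp only at h0 hl
    obtain ⟨G, hE, hN, hG⟩ := ih (x + 1) y (x₀ + C - x - 1) (y₀ + R - y) hl.2 fun c hc => by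
      have h1 := hl.1 c hc
      have h2 := hb c (by simp [hc])
      omega
    obtain ⟨b, hb'⟩ : ∃ b, y = y₀ + (b + 1) := ⟨y - y₀ - 1, by omega⟩
    -- Go right, then up to the first prescribed peak `(x, y)`. The `E` step that completes the peak
    -- makes the rest start at `(x + 1, y)`.
    refine ⟨List.replicate (x - x₀) Step.E ++ (List.replicate (b + 1) Step.N ++ Step.E :: G),
      ?_, ?_, fun c => ?_⟩
    · simp [List.count_replicate, hE]; omega
    · simp [List.count_replicate, hN]; omega
    · simp only [mem_peakCoords_replicate_E_append, mem_peakCoords_replicate_N_append_E_cons]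
      rw [List.mem_cons, hG]
      constructor
      · rintro (rfl | ⟨d, hd, rfl⟩)
        · exact ⟨_, ⟨_, Or.inl rfl, rfl⟩, by ext <;> simp <;> omega⟩
        · exact ⟨_, ⟨_, Or.inr ⟨d, hd, rfl⟩, rfl⟩, by ext <;> simp <;> omega⟩
      · rintro ⟨_, ⟨_, rfl | ⟨d, hd, rfl⟩, rfl⟩, rfl⟩
        · exact Or.inl (by ext <;> simp <;> omega)
        · exact Or.inr ⟨d, hd, by ext <;> simp <;> omega⟩

/-! ### The boundary of a partition -/

section
variable {n : ℕ} {lam : YoungDiagram}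

lemma rowLen_eq_of_forall {lam : YoungDiagram} {r m : ℕ} (h : ∀ c, (r, c) ∈ lam ↔ c < m) :
    lam.rowLen r = m := by
  have h1 := h m
  have h2 := h (lam.rowLen r)
  rw [YoungDiagram.mem_iff_lt_rowLen] at h1 h2
  omega

lemma colLen_eq_of_forall {lam : YoungDiagram} {c m : ℕ} (h : ∀ r, (r, c) ∈ lam ↔ r < m) :
    lam.colLen c = m := by
  have h1 := h m
  have h2 := h (lam.colLen c)
  rw [YoungDiagram.mem_iff_lt_colLen] at h1 h2
  omega

lemma rowLen_le (h : lam ∈ partitionsInBox n) (r : ℕ) : lam.rowLen r ≤ (n + 1) / 2 := by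
  by_contra hc
  have := h (r, (n + 1) / 2) (YoungDiagram.mem_iff_lt_rowLen.2 (not_le.1 hc))
  omega

lemma colLen_le (h : lam ∈ partitionsInBox n) (c : ℕ) : lam.colLen c ≤ n / 2 := by
  by_contra hc
  have := h (n / 2, c) (YoungDiagram.mem_iff_lt_colLen.2 (not_le.1 hc))
  omega

lemma rowLen_eq_zero (h : lam ∈ partitionsInBox n) {r : ℕ} (hr : n / 2 ≤ r) :
    lam.rowLen r = 0 := by
  by_contra hc
  have := h (r, 0) (YoungDiagram.mem_iff_lt_rowLen.2 (Nat.pos_of_ne_zero hc))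
  omega

/-- The part of the boundary of `lam` that traverses the first `k` rows. -/
def rowsBoundary (lam : YoungDiagram) (k : ℕ) : List Step :=
  (List.range k).reverse.flatMap fun r =>
    List.replicate (lam.rowLen r - lam.rowLen (r + 1)) Step.E ++ [Step.N]

lemma rowsBoundary_succ (lam : YoungDiagram) (k : ℕ) :
    rowsBoundary lam (k + 1) =
      List.replicate (lam.rowLen k - lam.rowLen (k + 1)) Step.E ++
        Step.N :: rowsBoundary lam k := by
  simp [rowsBoundary, List.range_succ]

lemma length_rowsBoundary (lam : YoungDiagram) (k : ℕ) :
    (rowsBoundary lam k).length = lam.rowLen 0 - lam.rowLen k + k := by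
  induction k with
  | zero => simp [rowsBoundary]
  | succ k ih =>
    have h1 := lam.rowLen_anti k (k + 1) (by omega)
    have h2 := lam.rowLen_anti 0 k (by omega)
    rw [rowsBoundary_succ]
    simp [ih]
    omega

lemma count_N_rowsBoundary (lam : YoungDiagram) (k : ℕ) :
    (rowsBoundary lam k).count Step.N = k := by
  induction k with
  | zero => simp [rowsBoundary]
  | succ k ih => rw [rowsBoundary_succ]; simp [ih, List.count_replicate]

/-- The `N` step of row `r` comes after `rowLen r - rowLen k` steps `E` and `k - 1 - r` steps `N`;
the equation avoids truncated subtraction. -/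
lemma rowsBoundary_getElem?_eq_N (lam : YoungDiagram) (k p : ℕ) :
    (rowsBoundary lam k)[p]? = some Step.N ↔
      ∃ r < k, p + lam.rowLen k + r + 1 = lam.rowLen r + k := by
  induction k generalizing p with
  | zero => simp [rowsBoundary]
  | succ k ih =>
    have h1 := lam.rowLen_anti k (k + 1) (by omega)
    rw [rowsBoundary_succ]
    rcases lt_trichotomy p (lam.rowLen k - lam.rowLen (k + 1)) with h | h | h
    · rw [List.getElem?_append_left (by simpa using h), List.getElem?_replicate, if_pos h]
      refine iff_of_false (by simp) ?_
      rintro ⟨r, hr, h'⟩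
      have := lam.rowLen_anti r k (by omega)
      omega
    · rw [List.getElem?_append_right (by simp [h])]
      refine iff_of_true (by simp [h]) ⟨k, by omega, by omega⟩
    · obtain ⟨q, hq⟩ : ∃ q, p = lam.rowLen k - lam.rowLen (k + 1) + (q + 1) :=
        ⟨p - (lam.rowLen k - lam.rowLen (k + 1)) - 1, by omega⟩
      rw [List.getElem?_append_right (by simp [h.le]), List.length_replicate, hq,
        Nat.add_sub_cancel_left, List.getElem?_cons_succ, ih]
      constructor
      · rintro ⟨r, hr, h'⟩
        exact ⟨r, by omega, by omega⟩
      · rintro ⟨r, hr, h'⟩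
        rcases (Nat.lt_succ_iff.1 hr).eq_or_lt with rfl | hr'
        · omega
        · exact ⟨r, hr', by omega⟩

lemma boundary_eq (n : ℕ) (lam : YoungDiagram) :
    boundary n lam =
      rowsBoundary lam (n / 2) ++ List.replicate ((n + 1) / 2 - lam.rowLen 0) Step.E := rfl

lemma length_boundary (h : lam ∈ partitionsInBox n) : (boundary n lam).length = n := by
  have h1 := rowLen_le h 0
  rw [boundary_eq, List.length_append, length_rowsBoundary, rowLen_eq_zero h le_rfl,
    List.length_replicate]
  omega

lemma boundary_mem_grandDyckPaths (h : lam ∈ partitionsInBox n) :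
    boundary n lam ∈ grandDyckPaths n := by
  have h1 : (boundary n lam).count Step.N = n / 2 := by
    rw [boundary_eq, List.count_append, count_N_rowsBoundary]
    simp [List.count_replicate]
  have h2 := count_N_add_count_E (boundary n lam)
  rw [length_boundary h] at h2
  exact ⟨length_boundary h, by omega, h1⟩

lemma boundary_getElem?_eq_N (h : lam ∈ partitionsInBox n) (p : ℕ) :
    (boundary n lam)[p]? = some Step.N ↔
      ∃ r < n / 2, p + r + 1 = lam.rowLen r + n / 2 := by
  have h0 := rowLen_eq_zero h le_rfl
  have hrow := rowsBoundary_getElem?_eq_N lam (n / 2) p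
  rw [h0, add_zero] at hrow
  rw [← hrow, boundary_eq]
  by_cases hp : p < (rowsBoundary lam (n / 2)).length
  · rw [List.getElem?_append_left hp]
  · rw [List.getElem?_append_right (by omega), List.getElem?_replicate,
      List.getElem?_eq_none (l := rowsBoundary lam (n / 2)) (by omega)]
    split_ifs <;> simp

/-- If `(r, c)` is a cell, both lengths exceed its coordinates; if not, neither does. Hence a row
and a column never claim the same boundary step. -/
lemma add_rowLen_colLen_ne (lam : YoungDiagram) (r c : ℕ) :
    lam.rowLen r + lam.colLen c ≠ r + c + 1 := by
  have h1 := lam.mem_iff_lt_rowLen (i := r) (j := c)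
  have h2 := lam.mem_iff_lt_colLen (i := r) (j := c)
  by_cases h : (r, c) ∈ lam
  · have := h1.1 h
    have := h2.1 h
    omega
  · rw [h1] at h
    rw [h1] at h2
    omega

lemma boundary_getElem?_eq_E_of (h : lam ∈ partitionsInBox n) {p c : ℕ} (hc : c < (n + 1) / 2)
    (hp : p + lam.colLen c = c + n / 2) : (boundary n lam)[p]? = some Step.E := by
  refine (step_cases (by rw [length_boundary h]; omega)).resolve_left fun hN => ?_
  obtain ⟨r, -, hr⟩ := (boundary_getElem?_eq_N h p).1 hN
  exact add_rowLen_colLen_ne lam r c (by omega)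

/-- The columns of the box supply distinct `E` positions, as many as the boundary has `E` steps, so
there are no others. -/
lemma boundary_getElem?_eq_E (h : lam ∈ partitionsInBox n) (p : ℕ) :
    (boundary n lam)[p]? = some Step.E ↔
      ∃ c < (n + 1) / 2, p + lam.colLen c = c + n / 2 := by
  refine ⟨fun hE => ?_, fun ⟨c, hc, hp⟩ => boundary_getElem?_eq_E_of h hc hp⟩
  have hcard := (boundary_mem_grandDyckPaths h).2.1
  rw [count_eq_card] at hcard
  have himg : (Finset.range ((n + 1) / 2)).image (fun c => c + n / 2 - lam.colLen c) =
      (Finset.range (boundary n lam).length).filter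
        fun p => (boundary n lam)[p]? = some Step.E := by
    refine Finset.eq_of_subset_of_card_le (fun q hq => ?_) ?_
    · obtain ⟨c, hc, rfl⟩ := Finset.mem_image.1 hq
      have h1 := colLen_le h c
      have := boundary_getElem?_eq_E_of h (Finset.mem_range.1 hc)
        (show c + n / 2 - lam.colLen c + lam.colLen c = c + n / 2 by omega)
      exact Finset.mem_filter.2 ⟨Finset.mem_range.2 (lt_length_of_getElem? this), this⟩
    · rw [hcard, Finset.card_image_of_injOn, Finset.card_range]
      intro c _ c' _ hcc
      have h1 := colLen_le h c
      have h2 := colLen_le h c'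
      simp only at hcc
      rcases lt_trichotomy c c' with h3 | h3 | h3
      · have := lam.colLen_anti c c' h3.le; omega
      · exact h3
      · have := lam.colLen_anti c' c h3.le; omega
  have hp : p ∈ (Finset.range (boundary n lam).length).filter
      fun p => (boundary n lam)[p]? = some Step.E :=
    Finset.mem_filter.2 ⟨Finset.mem_range.2 (lt_length_of_getElem? hE), hE⟩
  rw [← himg] at hp
  obtain ⟨c, hc, rfl⟩ := Finset.mem_image.1 hp
  have := colLen_le h c
  exact ⟨c, Finset.mem_range.1 hc, by omega⟩

/-- The set of `N` positions is the range of `r - rowLen r` up to reflection and shift, and a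
strictly monotone sequence is determined by its range. -/
lemma boundary_injOn (n : ℕ) : Set.InjOn (boundary n) (partitionsInBox n) := by
  intro lam h mu h' heq
  have hmono : ∀ nu : YoungDiagram,
      StrictMono fun r : Fin (n / 2) => (r : ℤ) - nu.rowLen r := fun nu r r' hrr => by
    have h1 : (r : ℕ) < r' := hrr
    have := nu.rowLen_anti r r' h1.le
    simp only
    omega
  have hsub : ∀ nu nu' : YoungDiagram, nu ∈ partitionsInBox n → nu' ∈ partitionsInBox n →
      boundary n nu = boundary n nu' →
      Set.range (fun r : Fin (n / 2) => (r : ℤ) - nu.rowLen r) ⊆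
        Set.range fun r : Fin (n / 2) => (r : ℤ) - nu'.rowLen r := by
    rintro nu nu' hnu hnu' heq _ ⟨r, rfl⟩
    have h1 := (boundary_getElem?_eq_N hnu (nu.rowLen r + n / 2 - r - 1)).2
      ⟨r, r.2, by have := r.2; omega⟩
    rw [heq] at h1
    obtain ⟨r', hr', h2⟩ := (boundary_getElem?_eq_N hnu' _).1 h1
    have := r.2
    exact ⟨⟨r', hr'⟩, by simp only; omega⟩
  have hrange := (hsub lam mu h h' heq).antisymm (hsub mu lam h' h heq.symm)
  have hfun := ((hmono lam).range_inj (hmono mu)).1 hrange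
  have hrow : ∀ r, lam.rowLen r = mu.rowLen r := fun r => by
    by_cases hr : r < n / 2
    · have := congrFun hfun ⟨r, hr⟩
      simp only at this
      omega
    · rw [rowLen_eq_zero h (by omega), rowLen_eq_zero h' (by omega)]
  ext ⟨r, c⟩
  rw [YoungDiagram.mem_cells, YoungDiagram.mem_cells, YoungDiagram.mem_iff_lt_rowLen,
    YoungDiagram.mem_iff_lt_rowLen, hrow]

lemma count_take_mono (w : List Step) (s : Step) {i j : ℕ} (h : i ≤ j) :
    (w.take i).count s ≤ (w.take j).count s := by
  rw [count_take_eq_card, count_take_eq_card]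
  exact Finset.card_le_card (Finset.filter_subset_filter _ (Finset.range_mono h))

open Classical in
/-- The partition in the box with `R` rows whose boundary is `w`. -/
noncomputable def diagramOfPath (R : ℕ) (w : List Step) : YoungDiagram where
  cells := (Finset.range R ×ˢ Finset.range (w.count Step.E)).filter fun c =>
    ∃ i ∈ Finset.range (w.length + 1),
      c.2 < (w.take i).count Step.E ∧ c.1 + (w.take i).count Step.N < R
  isLowerSet := by
    intro a b hba ha
    have h1 := hba.1
    have h2 := hba.2
    simp only [Finset.coe_filter, Finset.mem_product, Finset.mem_range, Set.mem_ofPred_eq] at ha ⊢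
    obtain ⟨⟨h3, h4⟩, i, h5, h6, h7⟩ := ha
    exact ⟨⟨by omega, by omega⟩, i, h5, by omega, by omega⟩

lemma mem_diagramOfPath {R : ℕ} {w : List Step} {r c : ℕ} :
    (r, c) ∈ diagramOfPath R w ↔
      ∃ i ≤ w.length, c < (w.take i).count Step.E ∧ r + (w.take i).count Step.N < R := by
  rw [← YoungDiagram.mem_cells]
  simp only [diagramOfPath, Finset.mem_filter, Finset.mem_product, Finset.mem_range,
    Nat.lt_succ_iff]
  refine ⟨fun h => h.2, fun h => ⟨?_, h⟩⟩
  obtain ⟨i, hi, h1, h2⟩ := h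
  have := count_take_mono w Step.E hi
  rw [List.take_length] at this
  omega

lemma count_take_le (w : List Step) (s : Step) (i : ℕ) : (w.take i).count s ≤ w.count s :=
  (List.take_sublist i w).count_le s

lemma boundary_surjOn (n : ℕ) :
    Set.SurjOn (boundary n) (partitionsInBox n) (grandDyckPaths n) := by
  rintro w ⟨hl, hE, hN⟩
  have hbox : diagramOfPath (n / 2) w ∈ partitionsInBox n := by
    rintro ⟨r, c⟩ hc
    obtain ⟨i, hi, h1, h2⟩ := mem_diagramOfPath.1 hc
    have := count_take_le w Step.E i
    exact ⟨by simp only; omega, by simp only; omega⟩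
  have hcount : ∀ p, p ≤ w.length → (w.take p).count Step.N + (w.take p).count Step.E = p :=
    fun p hp => by rw [count_N_add_count_E, List.length_take, min_eq_left hp]
  refine ⟨_, hbox, List.ext_getElem? fun p => ?_⟩
  by_cases hp : p < w.length
  swap
  · rw [List.getElem?_eq_none (by rw [length_boundary hbox]; omega),
      List.getElem?_eq_none (by omega)]
  have hcp := hcount p hp.le
  rcases step_cases hp with hs | hs <;> rw [hs]
  · have h1 := count_take_succ hs Step.N
    have h2 := count_take_le w Step.N (p + 1)
    rw [if_pos rfl] at h1
    rw [boundary_getElem?_eq_N hbox]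
    -- Rows are traversed from the bottom, so the earlier `N` steps are counted off from the last
    -- row `n / 2 - 1`.
    refine ⟨n / 2 - 1 - (w.take p).count Step.N, by omega, ?_⟩
    rw [rowLen_eq_of_forall (m := (w.take p).count Step.E) fun c => ?_]
    · omega
    rw [mem_diagramOfPath]
    constructor
    · rintro ⟨i, hi, h3, h4⟩
      have h5 : i ≤ p := by
        by_contra hc
        have := count_take_mono w Step.N (show p + 1 ≤ i by omega)
        omega
      exact h3.trans_le (count_take_mono w Step.E h5)
    · exact fun hc => ⟨p, hp.le, hc, by omega⟩
  · have h1 := count_take_succ hs Step.E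
    have h1' := count_take_succ hs Step.N
    have h2 := count_take_le w Step.E (p + 1)
    have h2' := count_take_le w Step.N p
    rw [if_pos rfl] at h1
    rw [if_neg (by simp)] at h1'
    refine boundary_getElem?_eq_E_of hbox (c := (w.take p).count Step.E) (by omega) ?_
    rw [colLen_eq_of_forall (m := n / 2 - (w.take p).count Step.N) fun r => ?_]
    · omega
    rw [mem_diagramOfPath]
    constructor
    · rintro ⟨i, hi, h3, h4⟩
      have h5 : p + 1 ≤ i := by
        by_contra hc
        have := count_take_mono w Step.E (show i ≤ p by omega)
        omega
      have := count_take_mono w Step.N h5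
      omega
    · exact fun hr => ⟨p + 1, hp, by omega, by omega⟩

lemma boundary_bijOn (n : ℕ) : Set.BijOn (boundary n) (partitionsInBox n) (grandDyckPaths n) :=
  ⟨fun _ h => boundary_mem_grandDyckPaths h, boundary_injOn n, boundary_surjOn n⟩

end

section
variable {n : ℕ} {lam : YoungDiagram}

/-! ### Hooks -/

lemma card_diagonal_le {k : ℕ} (h : (k, k) ∈ lam) : k + 1 ≤ lam.card := by
  have : (Finset.range (k + 1)).image (fun j => (j, j)) ⊆ lam.cells := fun c hc => by
    obtain ⟨j, hj, rfl⟩ := Finset.mem_image.1 hc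
    have := Finset.mem_range.1 hj
    exact lam.up_left_mem (by omega) (by omega) h
  have := Finset.card_le_card this
  rwa [Finset.card_image_of_injective _ fun a b h => (Prod.mk.inj h).1, Finset.card_range] at this

/-- The search bound `lam.card` is large enough because a cell `(k, k)` forces `k + 1` diagonal
cells. -/
lemma lt_durfee_iff {k : ℕ} : k < durfee lam ↔ (k, k) ∈ lam := by
  constructor
  · intro h
    have hspec := Nat.findGreatest_spec (P := fun k => k ≤ lam.rowLen (k - 1))
      (Nat.zero_le lam.card) (Nat.zero_le _)
    change durfee lam ≤ lam.rowLen (durfee lam - 1) at hspec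
    have hd : (durfee lam - 1, durfee lam - 1) ∈ lam :=
      YoungDiagram.mem_iff_lt_rowLen.2 (by omega)
    exact lam.up_left_mem (by omega) (by omega) hd
  · intro h
    refine Nat.le_findGreatest (card_diagonal_le h) ?_
    exact YoungDiagram.mem_iff_lt_rowLen.1 h

lemma lt_rowLen_iff_lt_durfee {k : ℕ} : k < lam.rowLen k ↔ k < durfee lam := by
  rw [lt_durfee_iff, YoungDiagram.mem_iff_lt_rowLen]

lemma lt_colLen_iff_lt_durfee {k : ℕ} : k < lam.colLen k ↔ k < durfee lam := by
  rw [lt_durfee_iff, YoungDiagram.mem_iff_lt_colLen]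

lemma mem_peel {c : ℕ × ℕ} : c ∈ peel lam ↔ (c.1 + 1, c.2 + 1) ∈ lam := by
  rw [← YoungDiagram.mem_cells]
  simp only [peel, Finset.mem_filter, YoungDiagram.mem_cells]
  exact ⟨fun h => h.2, fun h => ⟨lam.up_left_mem (by omega) (by omega) h, h⟩⟩

lemma mem_iterate_peel {j : ℕ} {c : ℕ × ℕ} :
    c ∈ peel^[j] lam ↔ (c.1 + j, c.2 + j) ∈ lam := by
  induction j generalizing c with
  | zero => rfl
  | succ j ih =>
    rw [Function.iterate_succ_apply', mem_peel, ih]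
    simp only [add_assoc, add_comm 1 j]

lemma card_largestHook_add_one (h : (0, 0) ∈ lam) :
    (largestHook lam).card + 1 = lam.rowLen 0 + lam.colLen 0 := by
  have h1 := Finset.card_union_add_card_inter (lam.row 0) (lam.col 0)
  have h2 : lam.row 0 ∪ lam.col 0 = largestHook lam := (Finset.filter_or _ _ _).symm
  have h3 : lam.row 0 ∩ lam.col 0 = {(0, 0)} := by
    ext ⟨a, b⟩
    simp only [Finset.mem_inter, YoungDiagram.mem_row_iff, YoungDiagram.mem_col_iff,
      Finset.mem_singleton, Prod.mk.injEq]
    constructor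
    · rintro ⟨⟨-, ha⟩, -, hb⟩; exact ⟨ha, hb⟩
    · rintro ⟨rfl, rfl⟩; exact ⟨⟨h, rfl⟩, h, rfl⟩
  rw [h2, h3, Finset.card_singleton, ← YoungDiagram.rowLen_eq_card,
    ← YoungDiagram.colLen_eq_card] at h1
  exact h1

/-- Peeling `j` times shifts the diagram by `j` along the diagonal, so this is the hook of `lam` at
`(j, j)`. The corner is counted with the leg; the summands are thus the coordinates of the `j`-th
hook point. -/
lemma card_largestHook_iterate_peel {j : ℕ} (hj : j < durfee lam) :
    (largestHook (peel^[j] lam)).card = lam.rowLen j - j - 1 + (lam.colLen j - j) := by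
  have h1 : (peel^[j] lam).rowLen 0 = lam.rowLen j - j := rowLen_eq_of_forall fun c => by
    rw [mem_iterate_peel, YoungDiagram.mem_iff_lt_rowLen, zero_add]; omega
  have h2 : (peel^[j] lam).colLen 0 = lam.colLen j - j := colLen_eq_of_forall fun c => by
    rw [mem_iterate_peel, YoungDiagram.mem_iff_lt_colLen, zero_add]; omega
  have h3 := card_largestHook_add_one (lam := peel^[j] lam)
    (mem_iterate_peel.2 (by simpa using lt_durfee_iff.1 hj))
  have h4 := lt_rowLen_iff_lt_durfee.2 hj
  omega

lemma card_eq_card_largestHook_add (lam : YoungDiagram) :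
    lam.card = (largestHook lam).card + (peel lam).card := by
  have h1 := Finset.card_filter_add_card_filter_not (s := lam.cells)
    fun c : ℕ × ℕ => c.1 = 0 ∨ c.2 = 0
  have h2 : (peel lam).card = (lam.cells.filter fun c => ¬ (c.1 = 0 ∨ c.2 = 0)).card := by
    refine Finset.card_nbij' (fun c => (c.1 + 1, c.2 + 1)) (fun c => (c.1 - 1, c.2 - 1)) ?_ ?_ ?_ ?_
    · intro c hc
      simpa using mem_peel.1 ((YoungDiagram.mem_cells _).1 hc)
    · intro c hc
      simp only [Finset.coe_filter, YoungDiagram.mem_cells, Set.mem_ofPred_eq] at hc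
      refine (YoungDiagram.mem_cells _).2 (mem_peel.2 ?_)
      have h3 : (c.1 - 1 + 1, c.2 - 1 + 1) = c :=
        Prod.ext (by simp only; omega) (by simp only; omega)
      simp only [h3]
      exact hc.1
    · intro c _
      simp
    · intro c hc
      simp only [Finset.coe_filter, YoungDiagram.mem_cells, Set.mem_ofPred_eq] at hc
      exact Prod.ext (by simp only; omega) (by simp only; omega)
  rw [h2]
  exact h1.symm

lemma card_eq_sum_add (lam : YoungDiagram) (k : ℕ) :
    lam.card = ∑ j ∈ Finset.range k, (largestHook (peel^[j] lam)).card + (peel^[k] lam).card := by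
  induction k with
  | zero => simp
  | succ k ih =>
    rw [Finset.sum_range_succ, Function.iterate_succ_apply', add_assoc,
      ← card_eq_card_largestHook_add]
    exact ih

lemma card_largestHook_lt {j k : ℕ} (hjk : j < k) (hk : k < durfee lam) :
    (largestHook (peel^[k] lam)).card < (largestHook (peel^[j] lam)).card := by
  rw [card_largestHook_iterate_peel hk, card_largestHook_iterate_peel (hjk.trans hk)]
  have h1 := lam.rowLen_anti j k hjk.le
  have h2 := lam.colLen_anti j k hjk.le
  have h3 := lt_rowLen_iff_lt_durfee.2 hk
  have h4 := lt_colLen_iff_lt_durfee.2 hk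
  omega

/-- The hooks exhaust the diagram after `durfee lam` peelings, and their sizes strictly decrease, so
collecting them in a set loses none. -/
lemma card_eq_sum_hookDecomposition (lam : YoungDiagram) :
    lam.card = ∑ h ∈ hookDecomposition lam, h := by
  have h0 : (peel^[durfee lam] lam).card = 0 := by
    refine Finset.card_eq_zero.2 (Finset.eq_empty_of_forall_notMem fun c hc => ?_)
    have := mem_iterate_peel.1 ((YoungDiagram.mem_cells _).1 hc)
    exact lt_irrefl _ (lt_durfee_iff.2 (lam.up_left_mem (by omega) (by omega) this))
  rw [hookDecomposition, Finset.sum_image, card_eq_sum_add lam (durfee lam), h0, add_zero]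
  intro j hj k hk hjk
  simp only [Finset.coe_range, Set.mem_Iio] at hj hk
  rcases lt_trichotomy j k with h | h | h
  · exact absurd hjk (card_largestHook_lt h hk).ne'
  · exact h
  · exact absurd hjk (card_largestHook_lt h hj).ne

/-! ### The map `ψ` -/

lemma mem_positions {s : Step} {w : List Step} {x : ℕ} :
    x ∈ positions s w ↔ 1 ≤ x ∧ w[x - 1]? = some s := by
  simp only [positions, List.mem_map, List.mem_filter, List.mem_range, decide_eq_true_eq]
  constructor
  · rintro ⟨p, ⟨-, h⟩, rfl⟩
    exact ⟨by omega, h⟩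
  · rintro ⟨h, h'⟩
    exact ⟨x - 1, ⟨lt_length_of_getElem? h', h'⟩, by omega⟩

lemma positions_pairwise (s : Step) (w : List Step) : (positions s w).Pairwise (· < ·) := by
  refine List.Pairwise.map _ (fun a b h => ?_) (List.Pairwise.filter _ List.pairwise_lt_range)
  exact Nat.succ_lt_succ h

lemma eq_of_pairwise_lt {l l' : List ℕ} (h : l.Pairwise (· < ·)) (h' : l'.Pairwise (· < ·))
    (hm : ∀ x, x ∈ l ↔ x ∈ l') : l = l' := by
  have hp : l.Perm l' := (List.perm_ext_iff_of_nodup (h.imp fun h => h.ne)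
    (h'.imp fun h => h.ne)).2 hm
  exact hp.eq_of_pairwise (fun a b _ _ h1 h2 => absurd h1 h2.asymm) h h'

lemma pairwise_map_reverse_range {α : Type*} {d : ℕ} {f : ℕ → α} {r : α → α → Prop}
    (hf : ∀ j k, j < k → k < d → r (f k) (f j)) :
    ((List.range d).reverse.map f).Pairwise r := by
  rw [List.pairwise_map, List.pairwise_reverse]
  exact List.pairwise_lt_range.imp_of_mem fun _ hb h => hf _ _ h (List.mem_range.1 hb)

/-- The `E` step of column `c` lies before the splitting point exactly when `c < colLen c`, at
distance `colLen c - c` from it. Both position lists run through the diagonal from its last cell, so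
zipping joins the row and the column of the same cell. -/
lemma positions_E_boundary (h : lam ∈ partitionsInBox n) :
    positions Step.E ((boundary n lam).take (n / 2)).reverse =
      (List.range (durfee lam)).reverse.map fun c => lam.colLen c - c := by
  have hl : ((boundary n lam).take (n / 2)).length = n / 2 := by
    rw [List.length_take, length_boundary h]; omega
  refine eq_of_pairwise_lt (positions_pairwise _ _) (pairwise_map_reverse_range ?_) fun x => ?_
  · intro j k hjk hk
    have := lam.colLen_anti j k hjk.le
    have := lt_colLen_iff_lt_durfee.2 hk
    omega
  · rw [mem_positions]
    simp only [List.mem_map, List.mem_reverse, List.mem_range, ← lt_colLen_iff_lt_durfee]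
    constructor
    · rintro ⟨h1, h2⟩
      have h3 := lt_length_of_getElem? h2
      rw [List.length_reverse, hl] at h3
      rw [List.getElem?_reverse (by omega), hl, List.getElem?_take, if_pos (by omega),
        boundary_getElem?_eq_E h] at h2
      obtain ⟨c, -, hc⟩ := h2
      exact ⟨c, by omega, by omega⟩
    · rintro ⟨c, hc, rfl⟩
      have h1 := colLen_le h c
      refine ⟨by omega, ?_⟩
      rw [List.getElem?_reverse (by omega), hl, List.getElem?_take, if_pos (by omega),
        boundary_getElem?_eq_E h]
      exact ⟨c, by omega, by omega⟩

lemma positions_N_boundary (h : lam ∈ partitionsInBox n) :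
    positions Step.N ((boundary n lam).drop (n / 2)) =
      (List.range (durfee lam)).reverse.map fun r => lam.rowLen r - r := by
  refine eq_of_pairwise_lt (positions_pairwise _ _) (pairwise_map_reverse_range ?_) fun x => ?_
  · intro j k hjk hk
    have := lam.rowLen_anti j k hjk.le
    have := lt_rowLen_iff_lt_durfee.2 hk
    omega
  · rw [mem_positions, List.getElem?_drop, boundary_getElem?_eq_N h]
    simp only [List.mem_map, List.mem_reverse, List.mem_range, ← lt_rowLen_iff_lt_durfee]
    constructor
    · rintro ⟨h1, r, hr, h2⟩
      exact ⟨r, by omega, by omega⟩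
    · rintro ⟨r, hr, rfl⟩
      have : r < n / 2 := by
        by_contra hc
        rw [rowLen_eq_zero h (not_lt.1 hc)] at hr
        omega
      exact ⟨by omega, r, this, by omega⟩

/-- The points `(b_j - 1, a_j)` of `lam` in terms of its rows and columns, by increasing
coordinates. -/
def hookPointList (lam : YoungDiagram) : List (ℕ × ℕ) :=
  (List.range (durfee lam)).reverse.map fun r => (lam.rowLen r - r - 1, lam.colLen r - r)

lemma mem_hookPointList {c : ℕ × ℕ} :
    c ∈ hookPointList lam ↔
      ∃ r < durfee lam, (lam.rowLen r - r - 1, lam.colLen r - r) = c := by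
  simp [hookPointList]

lemma hookPoints_eq (h : lam ∈ partitionsInBox n) :
    hookPoints n lam = (hookPointList lam).toFinset := by
  rw [hookPoints, positions_E_boundary h, positions_N_boundary h, List.zip_map', List.map_map]
  rfl

lemma mem_hookPoints (h : lam ∈ partitionsInBox n) {c : ℕ × ℕ} :
    c ∈ hookPoints n lam ↔
      ∃ r < durfee lam, (lam.rowLen r - r - 1, lam.colLen r - r) = c := by
  rw [hookPoints_eq h, List.mem_toFinset, mem_hookPointList]

lemma hookDecomposition_eq_image (h : lam ∈ partitionsInBox n) :
    hookDecomposition lam = (hookPoints n lam).image fun c => c.1 + c.2 := by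
  ext x
  simp only [hookDecomposition, Finset.mem_image, mem_hookPoints h, Finset.mem_range]
  constructor
  · rintro ⟨j, hj, rfl⟩
    exact ⟨_, ⟨j, hj, rfl⟩, (card_largestHook_iterate_peel hj).symm⟩
  · rintro ⟨_, ⟨j, hj, rfl⟩, rfl⟩
    exact ⟨j, hj, card_largestHook_iterate_peel hj⟩

lemma existsUnique_isHookToPeak (h : lam ∈ partitionsInBox n) :
    ∃! G, IsHookToPeak n lam G := by
  obtain ⟨G, hE, hN, hG⟩ := exists_path_with_peaks (hookPointList lam) 0 0 ((n + 1) / 2) (n / 2)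
    (pairwise_map_reverse_range fun j k hjk hk => by
      have := lam.rowLen_anti j k hjk.le
      have := lam.colLen_anti j k hjk.le
      have := lt_rowLen_iff_lt_durfee.2 hk
      have := lt_colLen_iff_lt_durfee.2 hk
      simp only
      omega)
    (fun c hc => by
      obtain ⟨r, hr, rfl⟩ := mem_hookPointList.1 hc
      have := lt_rowLen_iff_lt_durfee.2 hr
      have := lt_colLen_iff_lt_durfee.2 hr
      have := rowLen_le h r
      have := colLen_le h r
      simp only
      omega)
  refine ⟨G, ⟨⟨?_, hE, hN⟩, ?_⟩, ?_⟩
  · rw [← count_N_add_count_E, hE, hN]; omega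
  · ext c
    rw [hookPoints_eq h, List.mem_toFinset, hG]
    simp
  · rintro G' ⟨⟨-, hE', hN'⟩, hG'⟩
    refine eq_of_peakCoords_eq (hE'.trans hE.symm) (hN'.trans hN.symm) ?_
    rw [hG']
    ext c
    rw [hookPoints_eq h, List.mem_toFinset, hG]
    simp

lemma isHookToPeak_psi (h : lam ∈ partitionsInBox n) : IsHookToPeak n lam (psi n lam) :=
  Classical.epsilon_spec (existsUnique_isHookToPeak h).exists

/-! ### Bijectivity of `ψ`. -/

/-- The second coordinates mark the `E` steps before the splitting point and the first coordinates
the `N` steps after it, so the points recover the boundary. -/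
lemma boundary_getElem?_eq_E_iff_hookPoints (h : lam ∈ partitionsInBox n) (p : ℕ) :
    (boundary n lam)[p]? = some Step.E ↔
      (p < n / 2 ∧ ∃ c ∈ hookPoints n lam, p + c.2 = n / 2) ∨
        (n / 2 ≤ p ∧ p < n ∧ ¬ ∃ c ∈ hookPoints n lam, p = n / 2 + c.1) := by
  rcases Nat.lt_or_ge p (n / 2) with hp | hp
  · rw [boundary_getElem?_eq_E h]
    constructor
    · rintro ⟨c, -, hc⟩
      exact Or.inl ⟨hp, _, (mem_hookPoints h).2
        ⟨c, lt_colLen_iff_lt_durfee.1 (by omega), rfl⟩, by simp only; omega⟩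
    · rintro (⟨-, c, hc, hpc⟩ | ⟨h', -⟩)
      · obtain ⟨r, hr, rfl⟩ := (mem_hookPoints h).1 hc
        have := h _ (lt_durfee_iff.1 hr)
        have := lt_colLen_iff_lt_durfee.2 hr
        exact ⟨r, by omega, by simp only at hpc; omega⟩
      · omega
  · have hN : (boundary n lam)[p]? = some Step.N ↔
        ∃ c ∈ hookPoints n lam, p = n / 2 + c.1 := by
      rw [boundary_getElem?_eq_N h]
      constructor
      · rintro ⟨r, -, hr⟩
        exact ⟨_, (mem_hookPoints h).2
          ⟨r, lt_rowLen_iff_lt_durfee.1 (by omega), rfl⟩, by simp only; omega⟩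
      · rintro ⟨c, hc, hpc⟩
        obtain ⟨r, hr, rfl⟩ := (mem_hookPoints h).1 hc
        have := h _ (lt_durfee_iff.1 hr)
        have := lt_rowLen_iff_lt_durfee.2 hr
        exact ⟨r, by omega, by simp only at hpc; omega⟩
    rw [← hN]
    by_cases hpn : p < n
    · rcases step_cases (w := boundary n lam) (p := p) (by rwa [length_boundary h]) with hs | hs <;>
        simp [hs, hp, hpn]
    · rw [List.getElem?_eq_none (by rw [length_boundary h]; omega)]
      refine iff_of_false (by simp) ?_
      rintro (h' | h') <;> omega

lemma psi_injOn (n : ℕ) : Set.InjOn (psi n) (partitionsInBox n) := by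
  intro lam h mu h' heq
  have hpts : hookPoints n lam = hookPoints n mu := by
    rw [← (isHookToPeak_psi h).2, ← (isHookToPeak_psi h').2, heq]
  refine boundary_injOn n h h' (ext_steps ?_ fun p => ?_)
  · rw [length_boundary h, length_boundary h']
  · rw [boundary_getElem?_eq_E_iff_hookPoints h, boundary_getElem?_eq_E_iff_hookPoints h', hpts]

instance : Finite Step :=
  Finite.of_injective (fun s : Step => decide (s = Step.N)) fun s t h => by
    cases s <;> cases t <;> simp_all

lemma finite_grandDyckPaths (n : ℕ) : (grandDyckPaths n).Finite :=
  (List.finite_length_eq Step n).subset fun _ h => h.1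

/-- Surjectivity is a count: `boundary n` shows that the two finite sets are equinumerous. -/
lemma psi_bijOn (n : ℕ) : Set.BijOn (psi n) (partitionsInBox n) (grandDyckPaths n) := by
  have hmaps : Set.MapsTo (psi n) (partitionsInBox n) (grandDyckPaths n) :=
    fun _ h => (isHookToPeak_psi h).1
  refine ⟨hmaps, psi_injOn n, ?_⟩
  refine (Set.eq_of_subset_of_ncard_le hmaps.image_subset ?_ (finite_grandDyckPaths n)).ge
  rw [(psi_injOn n).ncard_image, ← (boundary_bijOn n).image_eq, (boundary_injOn n).ncard_image]

/-! ### The composite map -/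

lemma mainMap_mem {π : Equiv.Perm (Fin n)} (hπ : π ∈ involutions321 n) :
    mainMap n π ∈ partitionsInBox n ∧ psi n (mainMap n π) = xi (rho π) := by
  have h := (psi_bijOn n).surjOn (xi_mapsTo n (rho_mapsTo n hπ))
  exact ⟨Function.invFunOn_mem h, Function.invFunOn_eq h⟩

lemma mainMap_bijOn (n : ℕ) :
    Set.BijOn (mainMap n) (involutions321 n) (partitionsInBox n) := by
  refine ⟨fun π hπ => (mainMap_mem hπ).1, fun π hπ σ hσ h => ?_, fun lam h => ?_⟩
  · refine rho_injOn n hπ hσ (xi_injOn n (rho_mapsTo n hπ) (rho_mapsTo n hσ) ?_)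
    rw [← (mainMap_mem hπ).2, ← (mainMap_mem hσ).2, h]
  · obtain ⟨w, hw, hxi⟩ := xi_surjOn n ((psi_bijOn n).mapsTo h)
    obtain ⟨π, hπ, rfl⟩ := rho_surjOn n hw
    refine ⟨π, hπ, psi_injOn n (mainMap_mem hπ).1 h ?_⟩
    rw [(mainMap_mem hπ).2, hxi]

lemma hookDecomposition_mainMap {π : Equiv.Perm (Fin n)} (hπ : π ∈ involutions321 n) :
    hookDecomposition (mainMap n π) = descentSet π := by
  obtain ⟨h, h'⟩ := mainMap_mem hπ
  rw [hookDecomposition_eq_image h, ← (isHookToPeak_psi h).2, h', image_add_peakCoords,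
    peakPositions_xi (rho_mapsTo n hπ).2, descentSet_eq_peakPositions hπ]

end

end HookDescent

theorem mainTheorem1 (n k : ℕ) (i : Fin k → ℕ) (hi : StrictMono i)
    (hpos : ∀ j, 1 ≤ i j) (hlt : ∀ j, i j < n) (m : ℕ) (hm : m = ∑ j, i j) :
    -- the three maps are well-defined bijections
    Set.BijOn HookDescent.rho (HookDescent.involutions321 n) (HookDescent.dyckPrefixes n) ∧
    Set.BijOn HookDescent.xi (HookDescent.dyckPrefixes n) (HookDescent.grandDyckPaths n) ∧
    (∀ lam ∈ HookDescent.partitionsInBox n, ∃! G, HookDescent.IsHookToPeak n lam G) ∧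
    Set.BijOn (HookDescent.psi n) (HookDescent.partitionsInBox n)
      (HookDescent.grandDyckPaths n) ∧
    -- their composite restricts to the bijection with prescribed descent set
    Set.BijOn (HookDescent.mainMap n)
      {π | π ∈ HookDescent.involutions321 n ∧
        HookDescent.descentSet π = Finset.univ.image i}
      {lam | lam.card = m ∧ HookDescent.hookDecomposition lam = Finset.univ.image i ∧
        lam ∈ HookDescent.partitionsInBox n} := by
  refine ⟨HookDescent.rho_bijOn n, HookDescent.xi_bijOn n,
    fun lam h => HookDescent.existsUnique_isHookToPeak h, HookDescent.psi_bijOn n, ?_, ?_, ?_⟩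
  · rintro π ⟨hπ, hd⟩
    have hh := (HookDescent.hookDecomposition_mainMap hπ).trans hd
    refine ⟨?_, hh, (HookDescent.mainMap_mem hπ).1⟩
    -- Strict monotonicity of `i` makes the sum over its image equal to `∑ j, i j`.
    rw [HookDescent.card_eq_sum_hookDecomposition, hh, hm,
      Finset.sum_image fun a _ b _ h => hi.injective h]
  · exact (HookDescent.mainMap_bijOn n).injOn.mono fun π h => h.1
  · rintro lam ⟨-, hh, h⟩
    obtain ⟨π, hπ, rfl⟩ := (HookDescent.mainMap_bijOn n).surjOn h
    exact ⟨π, ⟨hπ, (HookDescent.hookDecomposition_mainMap hπ).symm.trans hh⟩, rfl⟩
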